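/- Let $L>0$, let $q\in L_2[0,L]$ be complex valued and let $H\in\mathbb{C}$. For $\rho\in\mathbb{C}$ let $T(\rho,\cdot)$ and $\psi(\rho,\cdot)$ be the solutions on $[0,L]$ of $$-y''+q(x)y=\rho^2y,\qquad 0<x<L,$$ with $T(\rho,L)=0$, $T'(\rho,L)=1$ and $\psi(\rho,L)=1$, $\psi'(\rho,L)=-H$, where the prime denotes $d/dx$ (a solution is a function $y$ that is differentiable on $[0,L]$, with $y'$ absolutely continuous, and that satisfies the equation almost everywhere). Put $$\omega_L(x)=\frac12\int_x^Lq(s)\,ds,\qquad \operatorname{sinc}(z)=\frac{\sin(\pi z)}{\pi z}\ (\operatorname{sinc}(0)=1),\qquad j_1(z)=\frac{\sin z}{z^2}-\frac{\cos z}{z}\ (j_1(0)=0).$$ Let $x\in[0,L)$. Then for all $\rho\in\mathbb{C}$ $$T'(\rho,x)=\cos(\rho(L-x))+\frac{\sin(\rho(L-x))}{\rho}\,\omega_L(x)+\frac{1}{2\rho\sin(\rho(L-x))}\sum_{n=0}^\infty \mathring t_n(x)\left(\operatorname{sinc}\left(\tfrac{2\rho(L-x)}{\pi}-2n-1\right)+\operatorname{sinc}\left(\tfrac{2\rho(L-x)}{\pi}+2n+1\right)\right),$$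 $$\mathring t_n(x)=\frac{(-1)^n(2n+1)\pi}{L-x}\,T'\left(\tfrac{2n+1}{2(L-x)}\pi,\,x\right)-2\omega_L(x),\qquad n=0,1,\dots,$$ and $$\psi'(\rho,x)=\rho\sin(\rho(L-x))+(H+\omega_L(x))\,\rho(L-x)\,j_1(\rho(L-x))+\sum_{n=0}^\infty\mathring\psi_n(x)\left(\operatorname{sinc}\left(\tfrac{\rho(x-L)}{\pi}-n\right)+\operatorname{sinc}\left(\tfrac{\rho(x-L)}{\pi}+n\right)\right),$$ $$\mathring\psi_0(x)=\frac{\psi'(0,x)}{2},\qquad \mathring\psi_n(x)=\psi'\left(\tfrac{n\pi}{L-x},\,x\right)+(-1)^n(H+\omega_L(x)),\qquad n=1,2,\dots$$ Here $\sin(\rho(L-x))/\rho$ is read as $L-x$ at $\rho=0$. In the first series the factor $1/(2\rho\sin(\rho(L-x)))$ is taken into each term, and the removable singularities of the terms, at the zeros of $\rho\sin(\rho(L-x))$, are filled in by continuity. Both series converge uniformly on compact subsets of the complex $\rho$-plane. For real $\rho$ they converge absolutely, uniformly on $\mathbb{R}$, and in the norm of $L_2(\mathbb{R})$. The same convergence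 statements hold for the first series without the factor $1/(2\rho\sin(\rho(L-x)))$, that is, for the cardinal series of $2\rho\sin(\rho(L-x))\left(T'(\rho,x)-\cos(\rho(L-x))-\frac{\sin(\rho(L-x))}{\rho}\omega_L(x)\right)$. -/

import Mathlib

open MeasureTheory Filter Topology

noncomputable section

namespace CardinalSeries

/-- The derivative `y'` on `[0, L]` (one-sided at the two end points). -/
def dx (L : ℝ) (y : ℝ → ℂ) (x : ℝ) : ℂ := derivWithin y (Set.Icc 0 L) x

/-- `y` solves `-y'' + q y = ρ² y` on `(0, L)` for a merely integrable potential: `y` is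
differentiable on `[0, L]`, `y'` is absolutely continuous on `[0, L]`, and the equation
holds almost everywhere. -/
structure IsSolution (q : ℝ → ℂ) (L : ℝ) (ρ : ℂ) (y : ℝ → ℂ) : Prop where
  differentiableOn : DifferentiableOn ℝ y (Set.Icc 0 L)
  absolutelyContinuous : AbsolutelyContinuousOnInterval (dx L y) 0 L
  equation : ∀ᵐ s ∂(volume.restrict (Set.Ioo 0 L)),
    ∃ y'' : ℂ, HasDerivAt (dx L y) y'' s ∧ -y'' + q s * y s = ρ ^ 2 * y s

/-- `ω_L(x) = (1/2) ∫_x^L q(s) ds`. -/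
def omegaL (q : ℝ → ℂ) (L x : ℝ) : ℂ := (1 / 2) * ∫ s in x..L, q s

/-- The normalized cardinal sine `sin (π z) / (π z)`, equal to `1` at `0`. -/
def nsinc (z : ℂ) : ℂ :=
  if z = 0 then 1 else Complex.sin (Real.pi * z) / (Real.pi * z)

/-- The spherical Bessel function of the first kind of order one,
`j₁(z) = sin z / z² - cos z / z`, equal to `0` at `0`. -/
def sphericalJ1 (z : ℂ) : ℂ :=
  if z = 0 then 0 else Complex.sin z / z ^ 2 - Complex.cos z / z

/-- The entire function `ρ ↦ sin (ρ l) / ρ`, equal to `l` at `ρ = 0`. -/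
def sinDiv (l : ℝ) (ρ : ℂ) : ℂ :=
  if ρ = 0 then (l : ℂ) else Complex.sin (ρ * l) / ρ

/-- `sinc (2 ρ l / π - 2 n - 1) + sinc (2 ρ l / π + 2 n + 1)`. -/
def oddPair (l : ℝ) (n : ℕ) (ρ : ℂ) : ℂ :=
  nsinc (2 * ρ * l / Real.pi - 2 * n - 1) + nsinc (2 * ρ * l / Real.pi + 2 * n + 1)

/-- `sinc (ρ d / π - n) + sinc (ρ d / π + n)`. -/
def evenPair (d : ℝ) (n : ℕ) (ρ : ℂ) : ℂ :=
  nsinc (ρ * d / Real.pi - n) + nsinc (ρ * d / Real.pi + n)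

/-- `oddPair l n ρ / (2 ρ sin (ρ l))`. The zeros of the denominator are removable
singularities, where the value is the limit of the quotient. -/
def oddQuot (l : ℝ) (n : ℕ) (ρ : ℂ) : ℂ :=
  if 2 * ρ * Complex.sin (ρ * l) = 0 then
    limUnder (𝓝[≠] ρ) (fun z : ℂ => oddPair l n z / (2 * z * Complex.sin (z * l)))
  else oddPair l n ρ / (2 * ρ * Complex.sin (ρ * l))

theorem continuous_nsinc : Continuous nsinc := by
  have h : nsinc = fun z : ℂ => dslope Complex.sin 0 (Real.pi * z) := by
    funext z
    by_cases hz : z = 0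
    · simp [nsinc, hz, dslope_same]
    · have : (Real.pi : ℂ) * z ≠ 0 := mul_ne_zero (by exact_mod_cast Real.pi_ne_zero) hz
      rw [dslope_of_ne _ this]
      simp [nsinc, hz, slope_def_field]
  rw [h]
  have hd : Continuous (dslope Complex.sin 0) := by
    rw [← continuousOn_univ, continuousOn_dslope Filter.univ_mem]
    exact ⟨Complex.continuous_sin.continuousOn, Complex.differentiableAt_sin⟩
  exact hd.comp (continuous_const.mul continuous_id)

theorem continuous_oddPair (l : ℝ) (n : ℕ) : Continuous (oddPair l n) := by
  unfold oddPair
  exact (continuous_nsinc.comp (by fun_prop)).add (continuous_nsinc.comp (by fun_prop))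

/-- At every point, `oddQuot` is the limit of the quotient that it extends. -/
theorem tendsto_oddQuot {l : ℝ} (hl : l ≠ 0) (n : ℕ) (ρ : ℂ) :
    Tendsto (fun z : ℂ => oddPair l n z / (2 * z * Complex.sin (z * l)))
      (𝓝[≠] ρ) (𝓝 (oddQuot l n ρ)) := by
  by_cases hD : 2 * ρ * Complex.sin (ρ * l) = 0
  · rw [oddQuot, if_pos hD]
    have hl' : (l : ℂ) ≠ 0 := by exact_mod_cast hl
    have hpi : (Real.pi : ℂ) ≠ 0 := by exact_mod_cast Real.pi_ne_zero
    have hs : Complex.sin (ρ * l) = 0 := by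
      rcases mul_eq_zero.1 hD with h | h
      · have : ρ = 0 := by simpa using h
        simp [this]
      · exact h
    have hc : Complex.cos (ρ * l) ≠ 0 := by
      intro h
      have := Complex.sin_sq_add_cos_sq (ρ * l)
      simp [hs, h] at this
    have hsm : ∀ y : ℂ, Complex.sin (y - (2 * n + 1) * Real.pi) = -Complex.sin y := by
      intro y
      have : y - (2 * n + 1) * Real.pi = (y - Real.pi) - n * (2 * Real.pi) := by ring
      rw [this, Complex.sin_sub_nat_mul_two_pi, Complex.sin_sub_pi]
    have hsp : ∀ y : ℂ, Complex.sin (y + (2 * n + 1) * Real.pi) = -Complex.sin y := by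
      intro y
      have : y + (2 * n + 1) * Real.pi = (y + Real.pi) + n * (2 * Real.pi) := by ring
      rw [this, Complex.sin_add_nat_mul_two_pi, Complex.sin_add_pi]
    have hcm : Complex.cos ((2 * n + 1) * Real.pi) = -1 := by
      have : ((2 * n + 1) * Real.pi : ℂ) = Real.pi + n * (2 * Real.pi) := by ring
      rw [this, Complex.cos_add_nat_mul_two_pi, Complex.cos_pi]
    have hc2 : Complex.cos (2 * (ρ * l)) = 1 := by
      rw [Complex.cos_two_mul, Complex.cos_sq', hs]; norm_num
    have h1 : 2 * ρ * l - (2 * n + 1) * Real.pi ≠ 0 := by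
      intro h
      have : 2 * (ρ * l) = (2 * n + 1) * Real.pi := by linear_combination h
      rw [this, hcm] at hc2
      norm_num at hc2
    have h2 : 2 * ρ * l + (2 * n + 1) * Real.pi ≠ 0 := by
      intro h
      have : 2 * (ρ * l) = -((2 * n + 1) * Real.pi) := by linear_combination h
      rw [this, Complex.cos_neg, hcm] at hc2
      norm_num at hc2
    have ev1 : ∀ᶠ z : ℂ in 𝓝[≠] ρ, 2 * z * l - (2 * n + 1) * Real.pi ≠ 0 :=
      (ContinuousAt.eventually_ne (g := fun z : ℂ => 2 * z * l - (2 * n + 1) * Real.pi)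
        (by fun_prop) h1).filter_mono nhdsWithin_le_nhds
    have ev2 : ∀ᶠ z : ℂ in 𝓝[≠] ρ, 2 * z * l + (2 * n + 1) * Real.pi ≠ 0 :=
      (ContinuousAt.eventually_ne (g := fun z : ℂ => 2 * z * l + (2 * n + 1) * Real.pi)
        (by fun_prop) h2).filter_mono nhdsWithin_le_nhds
    have ev3 : ∀ᶠ z : ℂ in 𝓝[≠] ρ, z ≠ 0 := (hasDerivAt_id ρ).eventually_ne one_ne_zero
    have ev4 : ∀ᶠ z : ℂ in 𝓝[≠] ρ, Complex.sin (z * l) ≠ 0 := by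
      have hd : HasDerivAt (fun z : ℂ => Complex.sin (z * l)) (Complex.cos (ρ * l) * (1 * l)) ρ :=
        ((hasDerivAt_id ρ).mul_const (l : ℂ)).csin
      exact hd.eventually_ne (mul_ne_zero hc (by simpa using hl'))
    have hlim : Tendsto (fun z : ℂ => -(4 * l * Complex.cos (z * l)) /
        ((2 * z * l - (2 * n + 1) * Real.pi) * (2 * z * l + (2 * n + 1) * Real.pi)))
        (𝓝[≠] ρ) (𝓝 (-(4 * l * Complex.cos (ρ * l)) /
        ((2 * ρ * l - (2 * n + 1) * Real.pi) * (2 * ρ * l + (2 * n + 1) * Real.pi)))) := by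
      refine Tendsto.mono_left (ContinuousAt.tendsto ?_) nhdsWithin_le_nhds
      exact ContinuousAt.div (by fun_prop) (by fun_prop) (mul_ne_zero h1 h2)
    have hq := hlim.congr' (f₂ := fun z : ℂ => oddPair l n z / (2 * z * Complex.sin (z * l))) (by
      filter_upwards [ev1, ev2, ev3, ev4] with z e1 e2 e3 e4
      have a1 : (Real.pi : ℂ) * (2 * z * l / Real.pi - 2 * n - 1)
          = 2 * z * l - (2 * n + 1) * Real.pi := by field_simp; ring
      have a2 : (Real.pi : ℂ) * (2 * z * l / Real.pi + 2 * n + 1)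
          = 2 * z * l + (2 * n + 1) * Real.pi := by field_simp; ring
      have b1 : 2 * z * l / Real.pi - 2 * n - 1 ≠ 0 := by
        intro h; rw [h, mul_zero] at a1; exact e1 a1.symm
      have b2 : 2 * z * l / Real.pi + 2 * n + 1 ≠ 0 := by
        intro h; rw [h, mul_zero] at a2; exact e2 a2.symm
      have hs2 : Complex.sin (2 * z * l) = 2 * Complex.sin (z * l) * Complex.cos (z * l) := by
        rw [← Complex.sin_two_mul]; ring_nf
      rw [oddPair, nsinc, nsinc, if_neg b1, if_neg b2, a1, a2, hsm, hsp, hs2,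
        div_add_div _ _ e1 e2, div_div, div_eq_div_iff (mul_ne_zero e1 e2)
          (mul_ne_zero (mul_ne_zero e1 e2) (mul_ne_zero (mul_ne_zero two_ne_zero e3) e4))]
      ring)
    exact tendsto_nhds_limUnder ⟨_, hq⟩
  · rw [oddQuot, if_neg hD]
    refine Tendsto.mono_left (ContinuousAt.tendsto ?_) nhdsWithin_le_nhds
    exact ContinuousAt.div (continuous_oddPair l n).continuousAt (by fun_prop) hD

/-- The coefficients of the series of `T'`. -/
def tCoeff (q : ℝ → ℂ) (L : ℝ) (T : ℂ → ℝ → ℂ) (x : ℝ) (n : ℕ) : ℂ :=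
  (-1) ^ n * ((2 * n + 1) * Real.pi / (L - x))
      * dx L (T ((2 * n + 1) / (2 * (L - x)) * Real.pi)) x
    - 2 * omegaL q L x

/-- The coefficients of the series of `ψ'`. -/
def psiCoeff (q : ℝ → ℂ) (L : ℝ) (H : ℂ) (ψ : ℂ → ℝ → ℂ) (x : ℝ) (n : ℕ) : ℂ :=
  if n = 0 then dx L (ψ 0) x / 2
  else dx L (ψ (n * Real.pi / (L - x))) x + (-1) ^ n * (H + omegaL q L x)

/-- The series `∑_{n ≥ 0} u n ρ` converges to `F ρ`: uniformly on compact subsets of `ℂ`,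
and, for real `ρ`, absolutely, uniformly on `ℝ`, and in the norm of `L₂(ℝ)`. -/
structure SeriesConverges (u : ℕ → ℂ → ℂ) (F : ℂ → ℂ) : Prop where
  compacts : ∀ K : Set ℂ, IsCompact K →
    TendstoUniformlyOn (fun N ρ => ∑ n ∈ Finset.range N, u n ρ) F atTop K
  absolutely : ∀ ρ : ℝ, Summable fun n => ‖u n (ρ : ℂ)‖
  uniformly : TendstoUniformly (fun N (ρ : ℝ) => ∑ n ∈ Finset.range N, u n (ρ : ℂ))
    (fun ρ : ℝ => F (ρ : ℂ)) atTop
  memLp_term : ∀ n, MemLp (fun ρ : ℝ => u n (ρ : ℂ)) 2 volume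
  memLp_sum : MemLp (fun ρ : ℝ => F (ρ : ℂ)) 2 volume
  tendsto_L2 : Tendsto
    (fun N : ℕ => eLpNorm (fun ρ : ℝ => F (ρ : ℂ) - ∑ n ∈ Finset.range N, u n (ρ : ℂ)) 2 volume)
    atTop (𝓝 0)

end CardinalSeries

end

noncomputable section

namespace CardinalSeries

/-! Reflect at `L`: with `l = L - x`, `p(s) = q(L - s)` and `u(t) = y(L - t)`, the solution
satisfies a Volterra equation on `[0, l]` with a free part `g ρ`, which is `sin(ρt)/ρ` for `-T` and
`cos(ρt)` for `ψ`. Up to explicit terms, `y'(x)` is then `-F(ρ)`, where `F(ρ) = ∫₀ˡ cos(ρ(l-s)) p u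
ds - ω_L(x) g ρ l`. The point is that `F(ρ)` is the pairing of `g ρ` with a fixed vector of `L₂(-l,
l)`. This is shown without constructing a transmutation kernel. For a finite combination `G = ∑ σ(ρ)
g ρ`, the function `Y(t,b) = ∑ σ(ρ) cos(ρb) u_ρ(t)` solves `Y_tt - Y_bb = pY` in d'Alembert's
integral form. A weighted supremum over a triangle (`exists_wave_bound`) bounds `Y` minus the free
wave `(G(t+b) + G(t-b))/2` by `C ∫|G|`. On the characteristic `b = l - s` the free wave is `(G(l) +
G(2s-l))/2`: its first half gives exactly the `ω_L` term, and the second is handled by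
Cauchy-Schwarz, because `p` is in `L₂`. So `∑ σ(ρ) F(ρ)` is bounded by the `L₂` norm of `G`
(`exists_functional_bound`), and Hahn-Banach with Riesz gives the vector
(`exists_inner_eq_of_bound`). The cardinal series is the Fourier expansion of that vector on `(-l,
l)`. For `ψ'` the frequencies `nπ/l` are those of the basis. For `T'` they are `(2n+1)π/(2l)`, so
the sine is first multiplied by the unimodular factor `exp(-iπt/(2l))`, which shifts frequencies by
half a step; the identity `sinc 2z = sinc z cos πz` then matches the terms with `oddQuot`. All
convergence statements except the absolute one come from norm convergence of the truncated vectors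
(`seriesConverges_of_hilbertBasis`): local boundedness of `ρ ↦ Φ ρ` gives compacts, boundedness on
the real line gives uniformity there, and a Plancherel inequality (`isBessel_expMap`) gives `L₂(ℝ)`.
Absolute convergence is summability in Parseval's formula. -/

/-! ### The functions `cos(ρt)` and `sin(ρt)/ρ`. -/

theorem sinDiv_eq_mul_nsinc (t : ℝ) (ρ : ℂ) : sinDiv t ρ = t * nsinc (ρ * t / Real.pi) := by
  have hpi : (Real.pi : ℂ) ≠ 0 := by exact_mod_cast Real.pi_ne_zero
  by_cases hρ : ρ = 0
  · simp [sinDiv, nsinc, hρ]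
  by_cases ht : t = 0
  · simp [sinDiv, hρ, ht]
  have ht' : (t : ℂ) ≠ 0 := by exact_mod_cast ht
  have h : ρ * t / Real.pi ≠ 0 := div_ne_zero (mul_ne_zero hρ ht') hpi
  rw [sinDiv, if_neg hρ, nsinc, if_neg h, mul_div_cancel₀ _ hpi]
  field_simp

theorem continuous_sinDiv : Continuous fun z : ℝ × ℂ => sinDiv z.1 z.2 := by
  simp_rw [sinDiv_eq_mul_nsinc]
  exact (by fun_prop : Continuous fun z : ℝ × ℂ => (z.1 : ℂ)).mul
    (continuous_nsinc.comp (by fun_prop))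

theorem mul_sinDiv (t : ℝ) (ρ : ℂ) : ρ * sinDiv t ρ = Complex.sin (ρ * t) := by
  by_cases hρ : ρ = 0
  · simp [hρ]
  · rw [sinDiv, if_neg hρ, mul_div_cancel₀ _ hρ]

@[simp] theorem sinDiv_zero (ρ : ℂ) : sinDiv 0 ρ = 0 := by simp [sinDiv]

theorem hasDerivAt_cos_mul (ρ : ℂ) (t : ℝ) :
    HasDerivAt (fun t : ℝ => Complex.cos (ρ * t)) (-(ρ * Complex.sin (ρ * t))) t := by
  have h : HasDerivAt (fun z : ℂ => Complex.cos (ρ * z)) (-Complex.sin (ρ * t) * (ρ * 1)) (t : ℂ) :=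
    ((hasDerivAt_id (t : ℂ)).const_mul ρ).ccos
  convert h.comp_ofReal using 1
  ring

theorem hasDerivAt_sinDiv (ρ : ℂ) (t : ℝ) :
    HasDerivAt (fun t : ℝ => sinDiv t ρ) (Complex.cos (ρ * t)) t := by
  by_cases hρ : ρ = 0
  · simp only [sinDiv, hρ, if_true, zero_mul, Complex.cos_zero]
    exact (hasDerivAt_id (t : ℂ)).comp_ofReal
  · have h : HasDerivAt (fun z : ℂ => Complex.sin (ρ * z) / ρ)
        (Complex.cos (ρ * t) * (ρ * 1) / ρ) (t : ℂ) :=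
      (((hasDerivAt_id (t : ℂ)).const_mul ρ).csin).div_const ρ
    simp only [sinDiv, hρ, if_false]
    convert h.comp_ofReal using 1
    field_simp

/-! ### Absolutely continuous functions and variation of constants. -/

/-- Serves to pass to real and imaginary parts, where the fundamental theorem of calculus for real
functions applies. -/
theorem _root_.AbsolutelyContinuousOnInterval.comp_continuousLinearMap {E F : Type*}
    [NormedAddCommGroup E] [NormedSpace ℝ E] [NormedAddCommGroup F] [NormedSpace ℝ F]
    {f : ℝ → E} {a b : ℝ} (hf : AbsolutelyContinuousOnInterval f a b) (A : E →L[ℝ] F) :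
    AbsolutelyContinuousOnInterval (fun s => A (f s)) a b := by
  unfold AbsolutelyContinuousOnInterval at hf ⊢
  have h := hf.const_mul ‖A‖
  rw [mul_zero] at h
  refine squeeze_zero (fun E => Finset.sum_nonneg fun i _ => dist_nonneg) (fun E => ?_) h
  rw [Finset.mul_sum]
  refine Finset.sum_le_sum fun i _ => ?_
  rw [dist_eq_norm, dist_eq_norm, ← map_sub]
  exact A.le_opNorm _

/-- The fundamental theorem of calculus for complex valued absolutely continuous functions. -/
theorem integral_eq_sub_of_absolutelyContinuous {f f' : ℝ → ℂ} {a b : ℝ} (hab : a ≤ b)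
    (hf : AbsolutelyContinuousOnInterval f a b)
    (h : ∀ᵐ s ∂(volume.restrict (Set.Ioo a b)), HasDerivAt f (f' s) s) :
    ∫ s in a..b, f' s = f b - f a := by
  have hre := hf.comp_continuousLinearMap Complex.reCLM
  have him := hf.comp_continuousLinearMap Complex.imCLM
  have hae : ∀ᵐ s ∂(volume.restrict (Set.uIoc a b)), HasDerivAt f (f' s) s := by
    rwa [Set.uIoc_of_le hab, ← restrict_Ioo_eq_restrict_Ioc]
  have e : f' =ᵐ[volume.restrict (Set.uIoc a b)] fun s =>
      ((deriv (fun s => Complex.reCLM (f s)) s : ℝ) : ℂ)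
        + ((deriv (fun s => Complex.imCLM (f s)) s : ℝ) : ℂ) * Complex.I := by
    filter_upwards [hae] with s hs
    have h1 : HasDerivAt (fun s => Complex.reCLM (f s)) (Complex.reCLM (f' s)) s :=
      Complex.reCLM.hasFDerivAt.comp_hasDerivAt s hs
    have h2 : HasDerivAt (fun s => Complex.imCLM (f s)) (Complex.imCLM (f' s)) s :=
      Complex.imCLM.hasFDerivAt.comp_hasDerivAt s hs
    rw [h1.deriv, h2.deriv]
    exact (Complex.re_add_im (f' s)).symm
  rw [intervalIntegral.integral_congr_ae_restrict e, intervalIntegral.integral_add,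
    intervalIntegral.integral_mul_const, intervalIntegral.integral_ofReal,
    intervalIntegral.integral_ofReal, hre.integral_deriv_eq_sub, him.integral_deriv_eq_sub]
  · apply Complex.ext <;> simp
  · exact ⟨hre.intervalIntegrable_deriv.1.ofReal, hre.intervalIntegrable_deriv.2.ofReal⟩
  · exact IntervalIntegrable.mul_const
      ⟨him.intervalIntegrable_deriv.1.ofReal, him.intervalIntegrable_deriv.2.ofReal⟩ _

section

variable {q : ℝ → ℂ} {L : ℝ} {ρ : ℂ} {y : ℝ → ℂ}

theorem IsSolution.continuousOn (hy : IsSolution q L ρ y) : ContinuousOn y (Set.Icc 0 L) :=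
  hy.differentiableOn.continuousOn

theorem IsSolution.hasDerivAt (hy : IsSolution q L ρ y) {s : ℝ} (hs : s ∈ Set.Ioo 0 L) :
    HasDerivAt y (dx L y s) s :=
  ((hy.differentiableOn s (Set.Ioo_subset_Icc_self hs)).hasDerivWithinAt).hasDerivAt
    (Icc_mem_nhds hs.1 hs.2)

theorem IsSolution.absolutelyContinuousOnInterval (hL : 0 < L) (hy : IsSolution q L ρ y) :
    AbsolutelyContinuousOnInterval y 0 L := by
  refine ContDiffOn.absolutelyContinuousOnInterval ?_
  -- `y'` is absolutely continuous, hence continuous, so `y` is of class `C¹` on `[0, L]`.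
  rw [Set.uIcc_of_le hL.le, show (1 : WithTop ℕ∞) = 0 + 1 by simp,
    contDiffOn_succ_iff_derivWithin (uniqueDiffOn_Icc hL)]
  refine ⟨hy.differentiableOn, by simp, ?_⟩
  rw [contDiffOn_zero]
  have := hy.absolutelyContinuous.continuousOn
  rwa [Set.uIcc_of_le hL.le] at this

/-- Lagrange's identity for a solution and a solution `c` of `c'' = -ρ² c`. -/
theorem IsSolution.lagrange (hL : 0 < L) (hy : IsSolution q L ρ y) {c c' : ℝ → ℂ}
    (hc : ∀ s, HasDerivAt c (c' s) s) (hc' : ∀ s, HasDerivAt c' (-(ρ ^ 2) * c s) s)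
    {x : ℝ} (hx : x ∈ Set.Icc 0 L) :
    ∫ s in x..L, c s * (q s * y s)
      = (c L * dx L y L - c' L * y L) - (c x * dx L y x - c' x * y x) := by
  have d1 : ContDiff ℝ 1 c' := by
    rw [contDiff_one_iff_deriv]
    refine ⟨fun s => (hc' s).differentiableAt, ?_⟩
    rw [funext fun s => (hc' s).deriv]
    exact continuous_const.mul (continuous_iff_continuousAt.2 fun s => (hc s).continuousAt)
  have d0 : ContDiff ℝ 1 c := by
    rw [contDiff_one_iff_deriv]
    refine ⟨fun s => (hc s).differentiableAt, ?_⟩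
    rw [funext fun s => (hc s).deriv]
    exact d1.continuous
  have hsub : Set.uIcc x L ⊆ Set.uIcc 0 L := by
    rw [Set.uIcc_of_le hL.le, Set.uIcc_of_le hx.2]
    exact Set.Icc_subset_Icc hx.1 le_rfl
  -- The Wronskian `c y' - c' y` has derivative `c q y`: the products `c' y'` cancel, and so do the
  -- `ρ²` terms.
  have ac : AbsolutelyContinuousOnInterval (fun s => c s • dx L y s - c' s • y s) x L :=
    (((d0.contDiffOn.absolutelyContinuousOnInterval).smul hy.absolutelyContinuous).sub
      ((d1.contDiffOn.absolutelyContinuousOnInterval).smul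
        (hy.absolutelyContinuousOnInterval hL))).mono hsub
  refine integral_eq_sub_of_absolutelyContinuous hx.2 ac ?_
  have heq := ae_mono (Measure.restrict_mono (Set.Ioo_subset_Ioo_left hx.1) le_rfl) hy.equation
  filter_upwards [heq, ae_restrict_mem measurableSet_Ioo] with s hs hsx
  obtain ⟨y'', h1, h2⟩ := hs
  have h0 := hy.hasDerivAt ⟨hx.1.trans_lt hsx.1, hsx.2⟩
  have h3 := ((hc s).mul h1).sub ((hc' s).mul h0)
  rwa [show c' s * dx L y s + c s * y'' - (-(ρ ^ 2) * c s * y s + c' s * dx L y s)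
    = c s * (q s * y s) by linear_combination -c s * h2] at h3

/-- The choice `c(x) = 1`, `c'(x) = 0` in Lagrange's identity isolates `y'(x)`. -/
theorem IsSolution.derivative_eq (hL : 0 < L) (hy : IsSolution q L ρ y) {x : ℝ}
    (hx : x ∈ Set.Icc 0 L) :
    dx L y x = Complex.cos (ρ * (L - x)) * dx L y L + ρ * Complex.sin (ρ * (L - x)) * y L
      - ∫ s in x..L, Complex.cos (ρ * (s - x)) * (q s * y s) := by
  have h := hy.lagrange hL (c := fun s => Complex.cos (ρ * (s - x)))
    (c' := fun s => -(ρ * Complex.sin (ρ * (s - x)))) (fun s => ?_) (fun s => ?_) hx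
  · rw [h]; simp
  · simpa using (hasDerivAt_cos_mul ρ (s - x)).comp_sub_const s x
  · have := (((hasDerivAt_sinDiv ρ (s - x)).comp_sub_const s x).const_mul (-(ρ ^ 2)))
    have e : (fun s : ℝ => -(ρ ^ 2) * sinDiv (s - x) ρ)
        = fun s : ℝ => -(ρ * Complex.sin (ρ * (s - x))) := by
      funext s
      have := mul_sinDiv (s - x) ρ
      push_cast at this
      rw [← this]; ring
    rwa [e, Complex.ofReal_sub] at this

/-- The choice `c(x) = 0`, `c'(x) = 1` isolates `y(x)`. -/
theorem IsSolution.eq_integral (hL : 0 < L) (hy : IsSolution q L ρ y) {x : ℝ}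
    (hx : x ∈ Set.Icc 0 L) :
    y x = Complex.cos (ρ * (L - x)) * y L - sinDiv (L - x) ρ * dx L y L
      + ∫ s in x..L, sinDiv (s - x) ρ * (q s * y s) := by
  have h := hy.lagrange hL (c := fun s => sinDiv (s - x) ρ)
    (c' := fun s => Complex.cos (ρ * (s - x))) (fun s => ?_) (fun s => ?_) hx
  · rw [h]; simp; ring
  · simpa using (hasDerivAt_sinDiv ρ (s - x)).comp_sub_const s x
  · have := (hasDerivAt_cos_mul ρ (s - x)).comp_sub_const s x
    rw [← mul_sinDiv, ← mul_assoc, ← pow_two, ← neg_mul] at this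
    simpa using this

end

/-! ### A priori estimate for the wave equation. -/

theorem intervalIntegrable_of_memLp {l t : ℝ} (ht : t ∈ Set.Icc 0 l) {p : ℝ → ℂ}
    (hp : MemLp p 2 (volume.restrict (Set.Icc 0 l))) : IntervalIntegrable p volume 0 t := by
  rw [intervalIntegrable_iff_integrableOn_Icc_of_le ht.1]
  exact (hp.integrable one_le_two).mono_measure
    (Measure.restrict_mono (Set.Icc_subset_Icc_right ht.2) le_rfl)

theorem intervalIntegrable_sq_of_memLp {l t : ℝ} (ht : t ∈ Set.Icc 0 l) {p : ℝ → ℂ}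
    (hp : MemLp p 2 (volume.restrict (Set.Icc 0 l))) :
    IntervalIntegrable (fun s => ‖p s‖ ^ 2) volume 0 t := by
  rw [intervalIntegrable_iff_integrableOn_Icc_of_le ht.1]
  exact (hp.integrable_norm_pow two_ne_zero).mono_measure
    (Measure.restrict_mono (Set.Icc_subset_Icc_right ht.2) le_rfl)

/-- A square integrable function has small integrals against steep exponentials. -/
theorem exists_exp_weight {l : ℝ} (hl : 0 < l) {p : ℝ → ℂ}
    (hp : MemLp p 2 (volume.restrict (Set.Icc 0 l))) {ε : ℝ} (hε : 0 < ε) :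
    ∃ r : ℝ, 0 < r ∧ ∀ t ∈ Set.Icc 0 l,
      ∫ s in (0 : ℝ)..t, ‖p s‖ * Real.exp (r * s) ≤ ε * Real.exp (r * t) := by
  set A : ℝ := ∫ s in (0 : ℝ)..l, ‖p s‖ ^ 2 with hA
  have hA0 : 0 ≤ A := intervalIntegral.integral_nonneg hl.le fun s _ => by positivity
  -- Each of the two terms of Young's inequality below is to cost at most `ε/2`: `δ` takes care of
  -- `‖p‖²`, and the rate `1/(2δε)` of the exponential. Adding 1 to `A` avoids division by zero.
  set δ : ℝ := ε / (A + 1) with hδ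
  have hδ0 : 0 < δ := by positivity
  refine ⟨1 / (2 * δ * ε), by positivity, fun t ht => ?_⟩
  set r : ℝ := 1 / (2 * δ * ε) with hr
  have hr0 : 0 < r := by positivity
  have i1 := intervalIntegrable_sq_of_memLp ht hp
  have i0 := (intervalIntegrable_of_memLp ht hp).norm
  -- Young's inequality `a z ≤ δa²/2 + z²/(2δ)` with `z = exp(r(s-t))`.
  have hpt : ∀ s, ‖p s‖ * Real.exp (r * s)
      ≤ Real.exp (r * t) * (δ / 2 * ‖p s‖ ^ 2 + 1 / (2 * δ) * Real.exp (2 * r * (s - t))) := by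
    intro s
    have e1 : Real.exp (r * s) = Real.exp (r * t) * Real.exp (r * (s - t)) := by
      rw [← Real.exp_add]; ring_nf
    have e2 : Real.exp (2 * r * (s - t)) = Real.exp (r * (s - t)) ^ 2 := by
      rw [← Real.exp_nat_mul]; push_cast; ring_nf
    rw [e1, e2, mul_left_comm]
    refine mul_le_mul_of_nonneg_left ?_ (Real.exp_pos _).le
    set z := Real.exp (r * (s - t))
    have : δ / 2 * ‖p s‖ ^ 2 + 1 / (2 * δ) * z ^ 2 - ‖p s‖ * z
        = 1 / (2 * δ) * (δ * ‖p s‖ - z) ^ 2 := by field_simp; ring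
    have h2 : 0 ≤ 1 / (2 * δ) * (δ * ‖p s‖ - z) ^ 2 := by positivity
    linarith
  have i2 : IntervalIntegrable (fun s => 1 / (2 * δ) * Real.exp (2 * r * (s - t))) volume 0 t :=
    (by fun_prop : Continuous _).intervalIntegrable _ _
  have hexp : ∫ s in (0 : ℝ)..t, Real.exp (2 * r * (s - t)) ≤ 1 / (2 * r) := by
    have hd : ∀ s ∈ Set.uIcc 0 t, HasDerivAt (fun s => Real.exp (2 * r * (s - t)) / (2 * r))
        (Real.exp (2 * r * (s - t))) s := fun s _ => by
      have := ((((hasDerivAt_id s).sub_const t).const_mul (2 * r)).exp).div_const (2 * r)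
      refine this.congr_deriv ?_
      rw [mul_one, mul_div_cancel_right₀ _ (by positivity), id]
    rw [intervalIntegral.integral_eq_sub_of_hasDerivAt hd
      ((by fun_prop : Continuous _).intervalIntegrable _ _)]
    have : 0 ≤ Real.exp (2 * r * (0 - t)) / (2 * r) := by positivity
    simp only [sub_self, mul_zero, Real.exp_zero]
    linarith
  have hAt : ∫ s in (0 : ℝ)..t, ‖p s‖ ^ 2 ≤ A :=
    intervalIntegral.integral_mono_interval le_rfl ht.1 ht.2
      (Eventually.of_forall fun s => by positivity)
      (intervalIntegrable_sq_of_memLp (Set.right_mem_Icc.2 hl.le) hp)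
  calc ∫ s in (0 : ℝ)..t, ‖p s‖ * Real.exp (r * s)
      ≤ ∫ s in (0 : ℝ)..t, Real.exp (r * t)
          * (δ / 2 * ‖p s‖ ^ 2 + 1 / (2 * δ) * Real.exp (2 * r * (s - t))) :=
        intervalIntegral.integral_mono_on ht.1
          (i0.mul_continuousOn (by fun_prop)) (((i1.const_mul _).add i2).const_mul _)
          fun s _ => hpt s
    _ = Real.exp (r * t) * (δ / 2 * (∫ s in (0 : ℝ)..t, ‖p s‖ ^ 2)
          + 1 / (2 * δ) * ∫ s in (0 : ℝ)..t, Real.exp (2 * r * (s - t))) := by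
        rw [intervalIntegral.integral_const_mul, intervalIntegral.integral_add (i1.const_mul _) i2,
          intervalIntegral.integral_const_mul, intervalIntegral.integral_const_mul]
    _ ≤ Real.exp (r * t) * (δ / 2 * A + 1 / (2 * δ) * (1 / (2 * r))) := by gcongr
    _ ≤ Real.exp (r * t) * ε := by
        gcongr
        have h1 : δ / 2 * A ≤ ε / 2 := by
          have : δ * A ≤ ε := by
            rw [hδ, div_mul_eq_mul_div, div_le_iff₀ (by positivity)]; nlinarith
          linarith
        have h2 : 1 / (2 * δ) * (1 / (2 * r)) = ε / 2 := by rw [hr]; field_simp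
        linarith
    _ = _ := mul_comm _ _

theorem integral_norm_comp_add_le {l : ℝ} {G : ℝ → ℂ} (hG : Continuous G) {a b c : ℝ}
    (hab : a ≤ b) (ha : -l ≤ a + c) (hb : b + c ≤ l) :
    ∫ v in a..b, ‖G (v + c)‖ ≤ ∫ v in (-l)..l, ‖G v‖ := by
  rw [intervalIntegral.integral_comp_add_right (fun v => ‖G v‖)]
  exact intervalIntegral.integral_mono_interval ha (by linarith) hb
    (Eventually.of_forall fun s => norm_nonneg _) (hG.norm.intervalIntegrable _ _)

theorem integral_norm_comp_sub_le {l : ℝ} {G : ℝ → ℂ} (hG : Continuous G) {a b c : ℝ}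
    (hab : a ≤ b) (ha : -l ≤ c - b) (hb : c - a ≤ l) :
    ∫ v in a..b, ‖G (c - v)‖ ≤ ∫ v in (-l)..l, ‖G v‖ := by
  rw [intervalIntegral.integral_comp_sub_left (fun v => ‖G v‖)]
  exact intervalIntegral.integral_mono_interval ha (by linarith) hb
    (Eventually.of_forall fun s => norm_nonneg _) (hG.norm.intervalIntegrable _ _)

/-- A priori bound for a wave equation `Y_tt - Y_bb = p Y` in the triangle `|b| ≤ l - t`, in
d'Alembert's integral form: the difference from the free wave is controlled by the integral of
the data. -/
theorem exists_wave_bound {l : ℝ} (hl : 0 < l) {p : ℝ → ℂ}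
    (hp : MemLp p 2 (volume.restrict (Set.Icc 0 l))) (h : ℂ) :
    ∃ C : ℝ, 0 ≤ C ∧ ∀ (G : ℝ → ℂ) (Y : ℝ → ℝ → ℂ), Continuous G →
      Continuous (Function.uncurry Y) →
      (∀ t ∈ Set.Icc 0 l, ∀ b, Y t b = (G (t + b) + G (t - b)) / 2
        + h / 4 * (∫ v in (-t)..t, (G (v + b) + G (v - b)))
        + 1 / 2 * ∫ s in (0 : ℝ)..t, p s * ∫ v in (b - (t - s))..(b + (t - s)), Y s v) →
      ∀ t ∈ Set.Icc 0 l, ∀ b, |b| ≤ l - t →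
        ‖Y t b - (G (t + b) + G (t - b)) / 2‖ ≤ C * ∫ v in (-l)..l, ‖G v‖ := by
  -- The Duhamel intervals have length at most `2l`, so `ε = 1/(2l)` makes the Duhamel term, with
  -- its factor `1/2`, a contraction with constant `1/2` in the weighted norm.
  obtain ⟨r, hr, hexp⟩ := exists_exp_weight hl hp (ε := 1 / (2 * l)) (by positivity)
  set P : ℝ := ∫ s in (0 : ℝ)..l, ‖p s‖ with hP
  have hP0 : 0 ≤ P := intervalIntegral.integral_nonneg hl.le fun s _ => norm_nonneg _
  refine ⟨Real.exp (r * l) * (‖h‖ + P), by positivity, fun G Y hG hY hYeq => ?_⟩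
  set N : ℝ := ∫ v in (-l)..l, ‖G v‖ with hN
  have hN0 : 0 ≤ N := intervalIntegral.integral_nonneg (by linarith) fun s _ => norm_nonneg _
  set R : ℝ → ℝ → ℂ := fun t b => Y t b - (G (t + b) + G (t - b)) / 2 with hR
  have hRc : Continuous (Function.uncurry R) := by
    refine hY.sub (Continuous.div_const (Continuous.add ?_ ?_) _)
    · exact hG.comp (by fun_prop)
    · exact hG.comp (by fun_prop)
  set D : Set (ℝ × ℝ) := {z | 0 ≤ z.1 ∧ z.1 ≤ l ∧ |z.2| ≤ l - z.1} with hD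
  have hDc : IsCompact D := by
    refine (isCompact_Icc (a := ((0 : ℝ), -l)) (b := (l, l))).of_isClosed_subset ?_ ?_
    · exact (isClosed_le continuous_const continuous_fst).inter
        ((isClosed_le continuous_fst continuous_const).inter
          (isClosed_le continuous_snd.abs (continuous_const.sub continuous_fst)))
    · rintro ⟨t, b⟩ ⟨h1, h2, h3⟩
      have := abs_le.1 h3
      simp only at h1 h2 this
      exact ⟨⟨h1, by simp only; linarith⟩, ⟨h2, by simp only; linarith⟩⟩
  have hDn : D.Nonempty := ⟨(0, 0), by simp [hD, hl.le]⟩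
  -- The weighted supremum is attained, hence finite, and can be absorbed after estimating at the
  -- maximum point only.
  obtain ⟨⟨t₀, b₀⟩, hz, hmax⟩ := hDc.exists_isMaxOn hDn
    (f := fun z : ℝ × ℝ => Real.exp (-(r * z.1)) * ‖Function.uncurry R z‖)
    (by fun_prop)
  set M : ℝ := Real.exp (-(r * t₀)) * ‖R t₀ b₀‖ with hM
  have hM0 : 0 ≤ M := by positivity
  have hRM : ∀ t b, 0 ≤ t → t ≤ l → |b| ≤ l - t → ‖R t b‖ ≤ M * Real.exp (r * t) := by
    intro t b h1 h2 h3
    have := hmax (show (t, b) ∈ D from ⟨h1, h2, h3⟩)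
    simp only [Set.mem_ofPred_eq, Function.uncurry] at this
    rw [Real.exp_neg] at this
    have e := Real.exp_pos (r * t)
    calc ‖R t b‖ = (Real.exp (r * t))⁻¹ * ‖R t b‖ * Real.exp (r * t) := by field_simp
      _ ≤ M * Real.exp (r * t) := by gcongr
  obtain ⟨ht0, htl, hb⟩ := hz
  simp only at ht0 htl hb
  have hb' := abs_le.1 hb
  have key : ‖R t₀ b₀‖ ≤ (‖h‖ + P) / 2 * N + M / 2 * Real.exp (r * t₀) := by
    have hinner : ∀ s ∈ Set.Icc 0 t₀, ‖∫ v in (b₀ - (t₀ - s))..(b₀ + (t₀ - s)), Y s v‖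
        ≤ N + 2 * l * M * Real.exp (r * s) := by
      intro s hs
      have hle : b₀ - (t₀ - s) ≤ b₀ + (t₀ - s) := by linarith [hs.2]
      have c1 : Continuous fun v => ‖G (v + s)‖ := (hG.comp (by fun_prop)).norm
      have c2 : Continuous fun v => ‖G (s - v)‖ := (hG.comp (by fun_prop)).norm
      have hpt : ∀ v ∈ Set.Icc (b₀ - (t₀ - s)) (b₀ + (t₀ - s)),
          ‖Y s v‖ ≤ 1 / 2 * ‖G (v + s)‖ + 1 / 2 * ‖G (s - v)‖ + M * Real.exp (r * s) := by
        intro v hv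
        -- The triangle contains the backward domain of dependence of each of its points, so the
        -- bound by `M` is available for every `(s, v)` in the integral.
        have hv' : |v| ≤ l - s := abs_le.2 ⟨by linarith [hv.1], by linarith [hv.2]⟩
        have e : Y s v = 1 / 2 * G (v + s) + 1 / 2 * G (s - v) + R s v := by
          simp only [hR]; rw [add_comm v s]; ring
        rw [e]
        refine (norm_add_le _ _).trans (add_le_add ((norm_add_le _ _).trans ?_)
          (hRM s v hs.1 (hs.2.trans htl) hv'))
        simp
      calc ‖∫ v in (b₀ - (t₀ - s))..(b₀ + (t₀ - s)), Y s v‖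
          ≤ ∫ v in (b₀ - (t₀ - s))..(b₀ + (t₀ - s)), ‖Y s v‖ :=
            intervalIntegral.norm_integral_le_integral_norm hle
        _ ≤ ∫ v in (b₀ - (t₀ - s))..(b₀ + (t₀ - s)),
              (1 / 2 * ‖G (v + s)‖ + 1 / 2 * ‖G (s - v)‖ + M * Real.exp (r * s)) :=
            intervalIntegral.integral_mono_on hle
              ((hY.comp (by fun_prop : Continuous fun v : ℝ => (s, v))).norm.intervalIntegrable _ _)
              ((by fun_prop : Continuous fun v : ℝ => 1 / 2 * ‖G (v + s)‖ + 1 / 2 * ‖G (s - v)‖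
                + M * Real.exp (r * s)).intervalIntegrable _ _) hpt
        _ = 1 / 2 * (∫ v in (b₀ - (t₀ - s))..(b₀ + (t₀ - s)), ‖G (v + s)‖)
              + 1 / 2 * (∫ v in (b₀ - (t₀ - s))..(b₀ + (t₀ - s)), ‖G (s - v)‖)
              + 2 * (t₀ - s) * (M * Real.exp (r * s)) := by
            rw [intervalIntegral.integral_add, intervalIntegral.integral_add,
              intervalIntegral.integral_const_mul, intervalIntegral.integral_const_mul,
              intervalIntegral.integral_const, smul_eq_mul]
            · ring
            all_goals exact (by fun_prop : Continuous _).intervalIntegrable _ _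
        _ ≤ 1 / 2 * N + 1 / 2 * N + 2 * l * (M * Real.exp (r * s)) := by
            gcongr
            · exact integral_norm_comp_add_le hG hle (by linarith [hs.1]) (by linarith [hs.1])
            · exact integral_norm_comp_sub_le hG hle (by linarith [hs.1]) (by linarith [hs.1])
            · linarith [hs.1]
        _ = _ := by ring
    have hip := (intervalIntegrable_of_memLp ⟨ht0, htl⟩ hp).norm
    have hhom : ‖∫ v in (-t₀)..t₀, (G (v + b₀) + G (v - b₀))‖ ≤ 2 * N := by
      have hle : -t₀ ≤ t₀ := by linarith
      have c1 : Continuous fun v => ‖G (v + b₀)‖ := (hG.comp (by fun_prop)).norm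
      have c2 : Continuous fun v => ‖G (v + -b₀)‖ := (hG.comp (by fun_prop)).norm
      calc ‖∫ v in (-t₀)..t₀, (G (v + b₀) + G (v - b₀))‖
          ≤ ∫ v in (-t₀)..t₀, ‖G (v + b₀) + G (v - b₀)‖ :=
            intervalIntegral.norm_integral_le_integral_norm hle
        _ ≤ ∫ v in (-t₀)..t₀, (‖G (v + b₀)‖ + ‖G (v + -b₀)‖) :=
            intervalIntegral.integral_mono_on hle
              ((by fun_prop : Continuous _).intervalIntegrable _ _)
              ((c1.add c2).intervalIntegrable _ _) fun v _ => norm_add_le _ _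
        _ = (∫ v in (-t₀)..t₀, ‖G (v + b₀)‖) + ∫ v in (-t₀)..t₀, ‖G (v + -b₀)‖ :=
            intervalIntegral.integral_add (c1.intervalIntegrable _ _) (c2.intervalIntegrable _ _)
        _ ≤ N + N := add_le_add
            (integral_norm_comp_add_le hG hle (by linarith) (by linarith))
            (integral_norm_comp_add_le hG hle (by linarith) (by linarith))
        _ = _ := by ring
    have hdu : ‖∫ s in (0 : ℝ)..t₀, p s * ∫ v in (b₀ - (t₀ - s))..(b₀ + (t₀ - s)), Y s v‖
        ≤ P * N + M * Real.exp (r * t₀) := by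
      calc ‖∫ s in (0 : ℝ)..t₀, p s * ∫ v in (b₀ - (t₀ - s))..(b₀ + (t₀ - s)), Y s v‖
          ≤ ∫ s in (0 : ℝ)..t₀, (‖p s‖ * N + 2 * l * M * (‖p s‖ * Real.exp (r * s))) := by
            refine intervalIntegral.norm_integral_le_of_norm_le ht0 (ae_of_all _ fun s hs => ?_)
              ((hip.mul_const _).add ((hip.mul_continuousOn (by fun_prop)).const_mul _))
            rw [norm_mul]
            refine (mul_le_mul_of_nonneg_left (hinner s ⟨hs.1.le, hs.2⟩) (norm_nonneg _)).trans
              (le_of_eq (by ring))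
        _ = (∫ s in (0 : ℝ)..t₀, ‖p s‖) * N
              + 2 * l * M * ∫ s in (0 : ℝ)..t₀, ‖p s‖ * Real.exp (r * s) := by
            rw [intervalIntegral.integral_add (hip.mul_const _)
              ((hip.mul_continuousOn (by fun_prop)).const_mul _),
              intervalIntegral.integral_mul_const, intervalIntegral.integral_const_mul]
        _ ≤ P * N + 2 * l * M * (1 / (2 * l) * Real.exp (r * t₀)) := by
            gcongr
            · exact intervalIntegral.integral_mono_interval le_rfl ht0 htl
                (Eventually.of_forall fun s => norm_nonneg _)
                (intervalIntegrable_of_memLp (Set.right_mem_Icc.2 hl.le) hp).norm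
            · exact hexp t₀ ⟨ht0, htl⟩
        _ = _ := by field_simp
    have e : R t₀ b₀ = h / 4 * (∫ v in (-t₀)..t₀, (G (v + b₀) + G (v - b₀)))
        + 1 / 2 * ∫ s in (0 : ℝ)..t₀, p s * ∫ v in (b₀ - (t₀ - s))..(b₀ + (t₀ - s)), Y s v := by
      simp only [hR]
      rw [hYeq t₀ ⟨ht0, htl⟩ b₀]; ring
    rw [e]
    refine (norm_add_le _ _).trans ?_
    rw [norm_mul, norm_mul, norm_div]
    norm_num
    nlinarith [norm_nonneg h]
  have hMle : M ≤ (‖h‖ + P) * N := by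
    have e1 : Real.exp (-(r * t₀)) * Real.exp (r * t₀) = 1 := by rw [← Real.exp_add]; simp
    have e2 : Real.exp (-(r * t₀)) ≤ 1 := Real.exp_le_one_iff.2 (by nlinarith)
    -- The weighted estimate at the maximum point has `M / 2` on the right, which moves to the left.
    have : M ≤ (‖h‖ + P) / 2 * N + M / 2 := by
      calc M ≤ Real.exp (-(r * t₀)) * ((‖h‖ + P) / 2 * N + M / 2 * Real.exp (r * t₀)) := by
            rw [hM]; gcongr
        _ = Real.exp (-(r * t₀)) * ((‖h‖ + P) / 2 * N)
            + M / 2 * (Real.exp (-(r * t₀)) * Real.exp (r * t₀)) := by ring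
        _ ≤ 1 * ((‖h‖ + P) / 2 * N) + M / 2 * 1 := by rw [e1]; gcongr
        _ = _ := by ring
    linarith
  intro t ht b hb
  calc ‖Y t b - (G (t + b) + G (t - b)) / 2‖ ≤ M * Real.exp (r * t) := hRM t b ht.1 ht.2 hb
    _ ≤ ((‖h‖ + P) * N) * Real.exp (r * l) := by gcongr; exact ht.2
    _ = _ := by ring

/-! ### From Volterra's equation to a functional bounded in `L₂`. -/

theorem integral_mul_le_sqrt_mul_sqrt {α : Type*} [MeasurableSpace α] {μ : Measure α}
    {f g : α → ℝ} (hf0 : ∀ x, 0 ≤ f x) (hg0 : ∀ x, 0 ≤ g x) (hf : MemLp f 2 μ)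
    (hg : MemLp g 2 μ) :
    ∫ x, f x * g x ∂μ ≤ √(∫ x, f x ^ 2 ∂μ) * √(∫ x, g x ^ 2 ∂μ) := by
  have e : (ENNReal.ofReal 2) = 2 := by simp
  have := integral_mul_le_Lp_mul_Lq_of_nonneg Real.HolderConjugate.two_two
    (ae_of_all μ hf0) (ae_of_all μ hg0) (by rwa [e]) (by rwa [e])
  simpa [Real.sqrt_eq_rpow] using this

theorem memLp_restrict_of_continuous {E : Type*} [NormedAddCommGroup E] {f : ℝ → E}
    (hf : Continuous f) (r : ENNReal) (a b : ℝ) : MemLp f r (volume.restrict (Set.Ioc a b)) := by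
  obtain ⟨C, hC⟩ := (isCompact_Icc (a := a) (b := b)).exists_bound_of_continuousOn hf.continuousOn
  refine MemLp.of_bound hf.aestronglyMeasurable C ?_
  filter_upwards [ae_restrict_mem measurableSet_Ioc] with s hs
  exact hC s (Set.Ioc_subset_Icc_self hs)

/-- Turns the Volterra kernel into d'Alembert's integral over the domain of dependence. -/
theorem cos_mul_sinDiv (ρ : ℂ) (b r : ℝ) :
    Complex.cos (ρ * b) * sinDiv r ρ
      = 1 / 2 * ∫ v in (b - r)..(b + r), Complex.cos (ρ * v) := by
  rw [intervalIntegral.integral_eq_sub_of_hasDerivAt (fun v _ => hasDerivAt_sinDiv ρ v)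
    ((by fun_prop : Continuous fun v : ℝ => Complex.cos (ρ * v)).intervalIntegrable _ _)]
  by_cases hρ : ρ = 0
  · simp [sinDiv, hρ]; ring
  · apply mul_left_cancel₀ hρ
    have h1 := mul_sinDiv r ρ
    have h2 := mul_sinDiv (b + r) ρ
    have h3 := mul_sinDiv (b - r) ρ
    push_cast at h2 h3
    rw [mul_add, Complex.sin_add] at h2
    rw [mul_sub, Complex.sin_sub] at h3
    linear_combination Complex.cos (ρ * b) * h1 - 1 / 2 * h2 + 1 / 2 * h3

/-- With `cos_mul_cos_eq_half`, this supplies the property of the free part `g` from which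
everything below is derived, so that both solutions are treated at once. -/
theorem cos_mul_sinDiv_eq_half (ρ : ℂ) (a t : ℝ) :
    Complex.cos (ρ * a) * sinDiv t ρ = (sinDiv (t + a) ρ + sinDiv (t - a) ρ) / 2 := by
  by_cases hρ : ρ = 0
  · simp [sinDiv, hρ]
  · apply mul_left_cancel₀ hρ
    have h1 := mul_sinDiv t ρ
    have h2 := mul_sinDiv (t + a) ρ
    have h3 := mul_sinDiv (t - a) ρ
    push_cast at h2 h3
    rw [mul_add, Complex.sin_add] at h2
    rw [mul_sub, Complex.sin_sub] at h3
    linear_combination Complex.cos (ρ * a) * h1 - 1 / 2 * h2 - 1 / 2 * h3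

theorem cos_mul_cos_eq_half (ρ : ℂ) (a t : ℝ) :
    Complex.cos (ρ * a) * Complex.cos (ρ * t)
      = (Complex.cos (ρ * ((t + a : ℝ) : ℂ)) + Complex.cos (ρ * ((t - a : ℝ) : ℂ))) / 2 := by
  push_cast
  rw [mul_add, mul_sub, Complex.cos_add, Complex.cos_sub]
  ring

/-- A solution of Volterra's equation, multiplied by `cos (ρ b)`, solves the wave equation. -/
theorem wave_of_volterra {t : ℝ} {p : ℝ → ℂ} (h ρ : ℂ) {g u : ℝ → ℂ}
    (hd : ∀ a τ : ℝ, Complex.cos (ρ * a) * g τ = (g (τ + a) + g (τ - a)) / 2)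
    (hV : u t = g t + h / 2 * (∫ v in (-t)..t, g v)
      + ∫ s in (0 : ℝ)..t, sinDiv (t - s) ρ * (p s * u s)) (b : ℝ) :
    Complex.cos (ρ * b) * u t = (g (t + b) + g (t - b)) / 2
        + h / 4 * (∫ v in (-t)..t, (g (v + b) + g (v - b)))
        + 1 / 2 * ∫ s in (0 : ℝ)..t, p s
            * ∫ v in (b - (t - s))..(b + (t - s)), Complex.cos (ρ * v) * u s := by
  have e1 : ∫ v in (-t)..t, (g (v + b) + g (v - b))
      = 2 * (Complex.cos (ρ * b) * ∫ v in (-t)..t, g v) := by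
    rw [← intervalIntegral.integral_const_mul, ← intervalIntegral.integral_const_mul]
    refine intervalIntegral.integral_congr fun v _ => ?_
    rw [hd]; ring
  have e2 : (∫ s in (0 : ℝ)..t, p s
        * ∫ v in (b - (t - s))..(b + (t - s)), Complex.cos (ρ * v) * u s)
      = 2 * (Complex.cos (ρ * b) * ∫ s in (0 : ℝ)..t, sinDiv (t - s) ρ * (p s * u s)) := by
    rw [← intervalIntegral.integral_const_mul, ← intervalIntegral.integral_const_mul]
    refine intervalIntegral.integral_congr fun s _ => ?_
    rw [intervalIntegral.integral_mul_const]
    linear_combination (-2 * p s * u s) * cos_mul_sinDiv ρ b (t - s)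
  rw [e1, e2, hV, ← hd]
  ring

/-- The wave equation for superpositions of solutions of Volterra's equation. -/
theorem wave_sum_of_volterra {l : ℝ} {p : ℝ → ℂ}
    (hp : MemLp p 2 (volume.restrict (Set.Icc 0 l))) (h : ℂ) {g u : ℂ → ℝ → ℂ}
    (hg : ∀ ρ, Continuous (g ρ))
    (hd : ∀ (ρ : ℂ) (a τ : ℝ), Complex.cos (ρ * a) * g ρ τ = (g ρ (τ + a) + g ρ (τ - a)) / 2)
    (hu : ∀ ρ, Continuous (u ρ)) (t : ℝ) (ht : t ∈ Set.Icc 0 l)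
    (hV : ∀ ρ, u ρ t = g ρ t + h / 2 * (∫ v in (-t)..t, g ρ v)
      + ∫ s in (0 : ℝ)..t, sinDiv (t - s) ρ * (p s * u ρ s)) (σ : ℂ →₀ ℂ) (b : ℝ) :
    ∑ ρ ∈ σ.support, σ ρ * (Complex.cos (ρ * b) * u ρ t)
      = ((∑ ρ ∈ σ.support, σ ρ * g ρ (t + b)) + ∑ ρ ∈ σ.support, σ ρ * g ρ (t - b)) / 2
        + h / 4 * (∫ v in (-t)..t,
          ((∑ ρ ∈ σ.support, σ ρ * g ρ (v + b)) + ∑ ρ ∈ σ.support, σ ρ * g ρ (v - b)))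
        + 1 / 2 * ∫ s in (0 : ℝ)..t, p s * ∫ v in (b - (t - s))..(b + (t - s)),
          ∑ ρ ∈ σ.support, σ ρ * (Complex.cos (ρ * v) * u ρ s) := by
  have e1 : ∫ v in (-t)..t,
        ((∑ ρ ∈ σ.support, σ ρ * g ρ (v + b)) + ∑ ρ ∈ σ.support, σ ρ * g ρ (v - b))
      = ∑ ρ ∈ σ.support, σ ρ * ∫ v in (-t)..t, (g ρ (v + b) + g ρ (v - b)) := by
    simp_rw [← intervalIntegral.integral_const_mul]
    rw [← intervalIntegral.integral_finsetSum]
    · simp only [← Finset.sum_add_distrib, mul_add]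
    · intro ρ _
      exact (by fun_prop : Continuous fun v => σ ρ * (g ρ (v + b) + g ρ (v - b))).intervalIntegrable
        _ _
  have e2 : (∫ s in (0 : ℝ)..t, p s * ∫ v in (b - (t - s))..(b + (t - s)),
        ∑ ρ ∈ σ.support, σ ρ * (Complex.cos (ρ * v) * u ρ s))
      = ∑ ρ ∈ σ.support, σ ρ * ∫ s in (0 : ℝ)..t, p s
          * ∫ v in (b - (t - s))..(b + (t - s)), Complex.cos (ρ * v) * u ρ s := by
    rw [Finset.sum_congr rfl fun ρ _ => (intervalIntegral.integral_const_mul (σ ρ) _).symm,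
      ← intervalIntegral.integral_finsetSum]
    · refine intervalIntegral.integral_congr fun s _ => ?_
      rw [intervalIntegral.integral_finsetSum]
      · rw [Finset.mul_sum]
        refine Finset.sum_congr rfl fun ρ _ => ?_
        rw [intervalIntegral.integral_const_mul]; ring
      · intro ρ _
        exact (by fun_prop : Continuous fun v : ℝ =>
          σ ρ * (Complex.cos (ρ * v) * u ρ s)).intervalIntegrable _ _
    · intro ρ _
      have : ∀ s : ℝ, p s * (∫ v in (b - (t - s))..(b + (t - s)), Complex.cos (ρ * v) * u ρ s)
          = p s * (2 * (Complex.cos (ρ * b) * sinDiv (t - s) ρ) * u ρ s) := fun s => by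
        rw [intervalIntegral.integral_mul_const, cos_mul_sinDiv]; ring
      simp_rw [this]
      refine ((intervalIntegrable_of_memLp ht hp).mul_continuousOn
        (Continuous.continuousOn ?_)).const_mul _
      have := continuous_sinDiv.comp (by fun_prop : Continuous fun s : ℝ => (t - s, ρ))
      exact (continuous_const.mul (continuous_const.mul this)).mul (hu ρ)
  rw [e1, e2, Finset.sum_congr rfl fun ρ _ => congrArg (σ ρ * ·)
    (wave_of_volterra h ρ (hd ρ) (hV ρ) b), ← Finset.sum_add_distrib, Finset.sum_div,
    Finset.mul_sum, Finset.mul_sum, ← Finset.sum_add_distrib, ← Finset.sum_add_distrib]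
  exact Finset.sum_congr rfl fun ρ _ => by ring

/-- Subtracting `G l / 2` is essential: point values are not controlled by the `L₂` norm. What
remains is `G(2s-l)/2`, paired with `p` by Cauchy-Schwarz, and an error controlled by the `L₁` norm
of `G`. -/
theorem norm_integral_sub_le {l C : ℝ} (hl : 0 < l) (hC : 0 ≤ C) {p : ℝ → ℂ}
    (hp : MemLp p 2 (volume.restrict (Set.Icc 0 l))) {G y : ℝ → ℂ} (hG : Continuous G)
    (hy : ∀ s ∈ Set.Icc 0 l, ‖y s - (G l + G (2 * s - l)) / 2‖ ≤ C * ∫ v in (-l)..l, ‖G v‖) :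
    ‖∫ s in (0 : ℝ)..l, p s * (y s - 1 / 2 * G l)‖
      ≤ (1 / 2 * √(∫ s in (0 : ℝ)..l, ‖p s‖ ^ 2) + C * (∫ s in (0 : ℝ)..l, ‖p s‖) * √(2 * l))
        * √(∫ v in (-l)..l, ‖G v‖ ^ 2) := by
  have hll : -l ≤ l := by linarith
  have hpi := intervalIntegrable_of_memLp (Set.right_mem_Icc.2 hl.le) hp
  have hP0 : 0 ≤ ∫ s in (0 : ℝ)..l, ‖p s‖ :=
    intervalIntegral.integral_nonneg hl.le fun s _ => norm_nonneg _
  have hGs : Continuous fun s : ℝ => ‖G (2 * s - l)‖ := (hG.comp (by fun_prop)).norm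
  have hGB : ∫ v in (-l)..l, ‖G v‖ ≤ √(2 * l) * √(∫ v in (-l)..l, ‖G v‖ ^ 2) := by
    have := integral_mul_le_sqrt_mul_sqrt (μ := volume.restrict (Set.Ioc (-l) l))
      (f := fun _ => 1) (g := fun v => ‖G v‖) (fun _ => zero_le_one) (fun _ => norm_nonneg _)
      (memLp_const 1) (memLp_restrict_of_continuous hG.norm _ _ _)
    simp only [← intervalIntegral.integral_of_le hll] at this
    simpa [← two_mul] using this
  have hCS : ∫ s in (0 : ℝ)..l, ‖p s‖ * ‖G (2 * s - l)‖
      ≤ √(∫ s in (0 : ℝ)..l, ‖p s‖ ^ 2) * √(∫ v in (-l)..l, ‖G v‖ ^ 2) := by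
    have := integral_mul_le_sqrt_mul_sqrt (μ := volume.restrict (Set.Ioc 0 l))
      (f := fun s => ‖p s‖) (g := fun s => ‖G (2 * s - l)‖) (fun _ => norm_nonneg _)
      (fun _ => norm_nonneg _)
      (hp.norm.mono_measure (Measure.restrict_mono Set.Ioc_subset_Icc_self le_rfl))
      (memLp_restrict_of_continuous hGs _ _ _)
    simp only [← intervalIntegral.integral_of_le hl.le] at this
    refine this.trans ?_
    have hB0 : 0 ≤ ∫ v in (-l)..l, ‖G v‖ ^ 2 :=
      intervalIntegral.integral_nonneg hll fun s _ => by positivity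
    gcongr
    -- As `s` runs over `[0, l]`, `2s - l` runs over `[-l, l]`; the Jacobian `1/2` is discarded.
    rw [intervalIntegral.integral_comp_mul_sub (fun v => ‖G v‖ ^ 2) two_ne_zero]
    simp only [mul_zero, zero_sub, show 2 * l - l = l by ring, smul_eq_mul]
    linarith
  generalize √(∫ v in (-l)..l, ‖G v‖ ^ 2) = B at *
  generalize hN : ∫ v in (-l)..l, ‖G v‖ = N at *
  have i1 : IntervalIntegrable (fun s => 1 / 2 * (‖p s‖ * ‖G (2 * s - l)‖)) volume 0 l :=
    (hpi.norm.mul_continuousOn hGs.continuousOn).const_mul _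
  have i2 : IntervalIntegrable (fun s => ‖p s‖ * (C * (√(2 * l) * B))) volume 0 l :=
    hpi.norm.mul_const _
  have hbound : ‖∫ s in (0 : ℝ)..l, p s * (y s - 1 / 2 * G l)‖
      ≤ ∫ s in (0 : ℝ)..l, (1 / 2 * (‖p s‖ * ‖G (2 * s - l)‖) + ‖p s‖ * (C * (√(2 * l) * B))) := by
    refine intervalIntegral.norm_integral_le_of_norm_le hl.le (ae_of_all _ fun s hs => ?_)
      (i1.add i2)
    have h1 := (hy s ⟨hs.1.le, hs.2⟩).trans (mul_le_mul_of_nonneg_left hGB hC)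
    have e3 : y s - 1 / 2 * G l
        = 1 / 2 * G (2 * s - l) + (y s - (G l + G (2 * s - l)) / 2) := by ring
    rw [norm_mul, e3]
    calc ‖p s‖ * ‖1 / 2 * G (2 * s - l) + (y s - (G l + G (2 * s - l)) / 2)‖
        ≤ ‖p s‖ * (‖1 / 2 * G (2 * s - l)‖ + C * (√(2 * l) * B)) :=
          mul_le_mul_of_nonneg_left ((norm_add_le _ _).trans (add_le_add le_rfl h1))
            (norm_nonneg _)
      _ = _ := by rw [norm_mul]; norm_num; ring
  refine hbound.trans ?_
  rw [intervalIntegral.integral_add i1 i2, intervalIntegral.integral_const_mul,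
    intervalIntegral.integral_mul_const]
  linarith

/-- The main part of the derivative of a solution of Volterra's equation, as a functional of the
free solution, is bounded for the `L₂` norm. -/
theorem exists_functional_bound {l : ℝ} (hl : 0 < l) {p : ℝ → ℂ}
    (hp : MemLp p 2 (volume.restrict (Set.Icc 0 l))) (h : ℂ) {g u : ℂ → ℝ → ℂ}
    (hg : ∀ ρ, Continuous (g ρ))
    (hd : ∀ (ρ : ℂ) (a τ : ℝ), Complex.cos (ρ * a) * g ρ τ = (g ρ (τ + a) + g ρ (τ - a)) / 2)
    (hu : ∀ ρ, Continuous (u ρ))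
    (hV : ∀ ρ, ∀ t ∈ Set.Icc 0 l, u ρ t = g ρ t + h / 2 * (∫ v in (-t)..t, g ρ v)
      + ∫ s in (0 : ℝ)..t, sinDiv (t - s) ρ * (p s * u ρ s)) :
    ∃ C : ℝ, ∀ σ : ℂ →₀ ℂ, ‖∑ ρ ∈ σ.support, σ ρ *
        ((∫ s in (0 : ℝ)..l, Complex.cos (ρ * (l - s)) * (p s * u ρ s))
          - (1 / 2 * ∫ s in (0 : ℝ)..l, p s) * g ρ l)‖
      ≤ C * √(∫ v in (-l)..l, ‖∑ ρ ∈ σ.support, σ ρ * g ρ v‖ ^ 2) := by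
  obtain ⟨C, hC0, hC⟩ := exists_wave_bound hl hp h
  refine ⟨1 / 2 * √(∫ s in (0 : ℝ)..l, ‖p s‖ ^ 2) + C * (∫ s in (0 : ℝ)..l, ‖p s‖) * √(2 * l),
    fun σ => ?_⟩
  have hpi := intervalIntegrable_of_memLp (Set.right_mem_Icc.2 hl.le) hp
  have hGc : Continuous fun v => ∑ ρ ∈ σ.support, σ ρ * g ρ v := by fun_prop
  have hYc : Continuous (Function.uncurry fun t b : ℝ =>
      ∑ ρ ∈ σ.support, σ ρ * (Complex.cos (ρ * b) * u ρ t)) := by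
    refine continuous_finsetSum _ fun ρ _ => continuous_const.mul (Continuous.mul ?_ ?_)
    · fun_prop
    · exact (hu ρ).comp continuous_fst
  have hR := hC _ _ hGc hYc fun t ht b =>
    wave_sum_of_volterra hp h hg hd hu t ht (fun ρ => hV ρ t ht) σ b
  -- The wave is evaluated on the characteristic `b = l - s`, where `t + b` is constantly `l`.
  have hfin := norm_integral_sub_le hl hC0 hp hGc
    (y := fun s => ∑ ρ ∈ σ.support, σ ρ * (Complex.cos (ρ * ((l - s : ℝ) : ℂ)) * u ρ s))
    (fun s hs => by
      have := hR s hs (l - s) (abs_of_nonneg (sub_nonneg.2 hs.2)).le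
      rwa [show s + (l - s) = l by ring, show s - (l - s) = 2 * s - l by ring] at this)
  refine le_of_eq_of_le (congrArg _ ?_) hfin
  have i1 : ∀ ρ : ℂ, IntervalIntegrable
      (fun s : ℝ => Complex.cos (ρ * (l - s)) * (p s * u ρ s)) volume 0 l := fun ρ =>
    (hpi.mul_continuousOn (hu ρ).continuousOn).continuousOn_mul (by fun_prop)
  have e1 : ∀ ρ : ℂ, σ ρ * ((∫ s in (0 : ℝ)..l, Complex.cos (ρ * (l - s)) * (p s * u ρ s))
      - (1 / 2 * ∫ s in (0 : ℝ)..l, p s) * g ρ l)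
      = ∫ s in (0 : ℝ)..l, (σ ρ * (Complex.cos (ρ * (l - s)) * (p s * u ρ s))
          - p s * (σ ρ * (1 / 2 * g ρ l))) := fun ρ => by
    rw [intervalIntegral.integral_sub ((i1 ρ).const_mul _) (hpi.mul_const _),
      intervalIntegral.integral_const_mul, intervalIntegral.integral_mul_const]
    ring
  rw [Finset.sum_congr rfl fun ρ _ => e1 ρ, ← intervalIntegral.integral_finsetSum
    fun ρ _ => ((i1 ρ).const_mul _).sub (hpi.mul_const _)]
  refine intervalIntegral.integral_congr fun s _ => ?_
  simp only [Finset.mul_sum, ← Finset.sum_sub_distrib]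
  exact Finset.sum_congr rfl fun ρ _ => by push_cast; ring

/-! ### Representing vectors and convergence in a Hilbert space. -/

section Hilbert

variable {E : Type*} [NormedAddCommGroup E] [InnerProductSpace ℂ E]

/-- A functional on finite combinations of vectors `φ ρ` that is bounded for the norm of `E` is
given by the inner product with a vector. -/
theorem exists_inner_eq_of_bound [CompleteSpace E] {ι : Type*} (φ : ι → E) (F : ι → ℂ) (C : ℝ)
    (h : ∀ σ : ι →₀ ℂ, ‖∑ ρ ∈ σ.support, σ ρ * F ρ‖ ≤ C * ‖∑ ρ ∈ σ.support, σ ρ • φ ρ‖) :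
    ∃ k : E, ∀ ρ, F ρ = inner ℂ k (φ ρ) := by
  let J := Finsupp.linearCombination ℂ φ
  let Λ := Finsupp.linearCombination ℂ F
  have hb : ∀ σ, ‖Λ σ‖ ≤ C * ‖J σ‖ := h
  -- The bound forces every linear relation among the `φ ρ` to hold among the `F ρ`, so the
  -- functional is well defined on their span.
  have hker : LinearMap.ker J ≤ LinearMap.ker Λ := by
    intro σ hσ
    rw [LinearMap.mem_ker] at hσ ⊢
    have := hb σ
    rw [hσ, norm_zero, mul_zero] at this
    exact norm_le_zero_iff.1 this
  let f₀ : LinearMap.range J →ₗ[ℂ] ℂ :=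
    ((LinearMap.ker J).liftQ Λ hker).comp J.quotKerEquivRange.symm.toLinearMap
  have hf₀ : ∀ σ, f₀ ⟨J σ, LinearMap.mem_range_self J σ⟩ = Λ σ := by
    intro σ
    have : J.quotKerEquivRange.symm ⟨J σ, LinearMap.mem_range_self J σ⟩
        = (LinearMap.ker J).mkQ σ := by
      rw [LinearEquiv.symm_apply_eq]; rfl
    simp only [f₀, LinearMap.comp_apply, LinearEquiv.coe_coe]
    rw [this]
    rfl
  let f : LinearMap.range J →L[ℂ] ℂ := f₀.mkContinuous C (by
    rintro ⟨_, σ, rfl⟩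
    rw [hf₀]
    exact hb σ)
  -- The span need not be closed: extend by Hahn-Banach, then apply Riesz.
  obtain ⟨g, hg, -⟩ := exists_extension_norm_eq (LinearMap.range J) f
  refine ⟨(InnerProductSpace.toDual ℂ E).symm g, fun ρ => ?_⟩
  rw [InnerProductSpace.toDual_symm_apply]
  have h1 : J (Finsupp.single ρ 1) = φ ρ := by simp [J]
  have h2 := hg ⟨J (Finsupp.single ρ 1), LinearMap.mem_range_self J _⟩
  have h3 : f ⟨J (Finsupp.single ρ 1), LinearMap.mem_range_self J _⟩ = F ρ := by
    change f₀ _ = _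
    rw [hf₀]
    simp [Λ]
  rw [← h3, ← h2, ← h1]

/-- The map `k ↦ ⟪k, Φ ·⟫` is bounded from `E` to `L₂(ℝ)`. -/
def IsBessel (Φ : ℝ → E) : Prop :=
  ∃ C : NNReal, ∀ k : E, eLpNorm (fun ρ : ℝ => inner ℂ k (Φ ρ)) 2 volume ≤ C * ‖k‖ₑ

theorem IsBessel.add {Φ Ψ : ℝ → E} (hΦ : IsBessel Φ) (hΨ : IsBessel Ψ) (cΦ : Continuous Φ)
    (cΨ : Continuous Ψ) : IsBessel fun ρ => Φ ρ + Ψ ρ := by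
  obtain ⟨C, hC⟩ := hΦ
  obtain ⟨D, hD⟩ := hΨ
  refine ⟨C + D, fun k => ?_⟩
  simp only [inner_add_right]
  refine (eLpNorm_add_le (f := fun ρ : ℝ => inner ℂ k (Φ ρ)) (g := fun ρ : ℝ => inner ℂ k (Ψ ρ))
    (by fun_prop : Continuous _).aestronglyMeasurable
    (by fun_prop : Continuous _).aestronglyMeasurable one_le_two).trans ?_
  rw [ENNReal.coe_add, add_mul]
  exact add_le_add (hC k) (hD k)

/-- Multiplication by a bounded function. -/
theorem IsBessel.mono {Φ Ψ : ℝ → E} (hΦ : IsBessel Φ) {M : NNReal}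
    (h : ∀ k ρ, ‖inner ℂ k (Ψ ρ)‖ ≤ M * ‖inner ℂ k (Φ ρ)‖) : IsBessel Ψ := by
  obtain ⟨C, hC⟩ := hΦ
  refine ⟨M * C, fun k => ?_⟩
  refine (eLpNorm_le_nnreal_smul_eLpNorm_of_ae_le_mul (c := M)
    (g := fun ρ : ℝ => (inner ℂ k (Φ ρ) : ℂ)) (ae_of_all _ fun ρ => ?_) 2).trans ?_
  · exact_mod_cast h k ρ
  · rw [ENNReal.smul_def, smul_eq_mul, ENNReal.coe_mul, mul_assoc]
    gcongr
    exact hC k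

theorem IsBessel.comp {Φ : ℝ → E} (hΦ : IsBessel Φ) (cΦ : Continuous Φ) {f : ℝ → ℝ}
    (hf : MeasurePreserving f volume volume) : IsBessel fun ρ => Φ (f ρ) := by
  obtain ⟨C, hC⟩ := hΦ
  refine ⟨C, fun k => ?_⟩
  have := eLpNorm_comp_measurePreserving (g := fun ρ : ℝ => inner ℂ k (Φ ρ)) (p := 2)
    (by fun_prop : Continuous _).aestronglyMeasurable hf
  exact this.trans_le (hC k)

/-- A family that decays like `1 / ρ`. -/
theorem isBessel_of_norm_le {Φ : ℝ → E} {M : ℝ} (hM : 0 ≤ M)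
    (h : ∀ ρ : ℝ, ‖Φ ρ‖ ^ 2 ≤ M * (1 + ρ ^ 2)⁻¹) : IsBessel Φ := by
  have hint : Integrable (fun ρ : ℝ => M * (1 + ρ ^ 2)⁻¹) := integrable_inv_one_add_sq.const_mul M
  refine ⟨(∫ ρ : ℝ, M * (1 + ρ ^ 2)⁻¹).toNNReal ^ (1 / 2 : ℝ), fun k => ?_⟩
  have h0 : ∀ ρ : ℝ, 0 ≤ M * (1 + ρ ^ 2)⁻¹ := fun ρ => by positivity
  rw [eLpNorm_eq_lintegral_rpow_enorm_toReal two_ne_zero ENNReal.ofNat_ne_top]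
  have e1 : ∫⁻ ρ : ℝ, ‖inner ℂ k (Φ ρ)‖ₑ ^ (2 : ENNReal).toReal
      ≤ ENNReal.ofReal (∫ ρ : ℝ, M * (1 + ρ ^ 2)⁻¹) * ‖k‖ₑ ^ (2 : ℝ) := by
    rw [ofReal_integral_eq_lintegral_ofReal hint (ae_of_all _ h0), ← lintegral_mul_const']
    · refine lintegral_mono fun ρ => ?_
      have a1 : ‖inner ℂ k (Φ ρ)‖ ^ 2 ≤ M * (1 + ρ ^ 2)⁻¹ * ‖k‖ ^ 2 := by
        calc ‖inner ℂ k (Φ ρ)‖ ^ 2 ≤ (‖k‖ * ‖Φ ρ‖) ^ 2 := by gcongr; exact norm_inner_le_norm _ _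
          _ = ‖Φ ρ‖ ^ 2 * ‖k‖ ^ 2 := by ring
          _ ≤ _ := by gcongr; exact h ρ
      have a2 := ENNReal.ofReal_le_ofReal a1
      rw [ENNReal.ofReal_mul (h0 ρ), ENNReal.ofReal_pow (norm_nonneg _),
        ENNReal.ofReal_pow (norm_nonneg _), ofReal_norm, ofReal_norm] at a2
      simpa using a2
    · simp
  refine (ENNReal.rpow_le_rpow e1 (by simp)).trans ?_
  rw [ENNReal.mul_rpow_of_nonneg _ _ (by simp), ← ENNReal.rpow_mul]
  simp only [ENNReal.toReal_ofNat, one_div, isUnit_iff_ne_zero, ne_eq, OfNat.ofNat_ne_zero,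
    not_false_eq_true, IsUnit.mul_inv_cancel, ENNReal.rpow_one]
  gcongr
  rw [ENNReal.coe_rpow_of_nonneg _ (by positivity)]
  rfl

/-- The expansion of `⟪k, Φ ρ⟫` in a Hilbert basis converges in all the senses of
`SeriesConverges`. -/
theorem seriesConverges_of_hilbertBasis [CompleteSpace E] {ι : Type*} (b : HilbertBasis ι ℂ E)
    {s : ℕ → Finset ι} (hs : Tendsto s atTop atTop) {Φ : ℂ → E} (hΦ : Continuous Φ) {M : ℝ}
    (hM : ∀ ρ : ℝ, ‖Φ ρ‖ ≤ M) (hB : IsBessel fun ρ : ℝ => Φ ρ) (k : E) {u : ℕ → ℂ → ℂ} {F : ℂ → ℂ}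
    (hF : ∀ ρ, F ρ = inner ℂ k (Φ ρ))
    (hu : ∀ N ρ, ∑ n ∈ Finset.range N, u n ρ
      = ∑ i ∈ s N, inner ℂ k (b i) * inner ℂ (b i) (Φ ρ))
    (habs : ∀ ρ : ℝ, Summable fun n => ‖u n (ρ : ℂ)‖) : SeriesConverges u F := by
  -- Partial sums of the series are pairings with the truncated vectors `K N`, so every error is `⟪k
  -- - K N, Φ ρ⟫` with `K N → k` independently of `ρ`.
  set K : ℕ → E := fun N => ∑ i ∈ s N, (inner ℂ (b i) k : ℂ) • b i with hK
  have hKlim : Tendsto (fun N => ‖k - K N‖) atTop (𝓝 0) := by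
    have h1 : HasSum (fun i => (inner ℂ (b i) k : ℂ) • b i) k := by
      simpa [b.repr_apply_apply] using b.hasSum_repr k
    have h2 : Tendsto K atTop (𝓝 k) := h1.comp hs
    simpa [norm_sub_rev] using tendsto_iff_norm_sub_tendsto_zero.1 h2
  have hS : ∀ N ρ, ∑ n ∈ Finset.range N, u n ρ = inner ℂ (K N) (Φ ρ) := by
    intro N ρ
    rw [hu, hK, sum_inner]
    refine Finset.sum_congr rfl fun i _ => ?_
    rw [inner_smul_left, inner_conj_symm]
  have hD : ∀ N ρ, F ρ - ∑ n ∈ Finset.range N, u n ρ = inner ℂ (k - K N) (Φ ρ) := by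
    intro N ρ
    rw [hS, hF, inner_sub_left]
  have hbd : ∀ (A : Set ℂ) (C : ℝ), (∀ ρ ∈ A, ‖Φ ρ‖ ≤ C) →
      TendstoUniformlyOn (fun N ρ => ∑ n ∈ Finset.range N, u n ρ) F atTop A := by
    intro A C hC
    rw [Metric.tendstoUniformlyOn_iff]
    intro ε hε
    have h0 : Tendsto (fun N => ‖k - K N‖ * |C|) atTop (𝓝 0) := by
      simpa using hKlim.mul_const |C|
    filter_upwards [h0.eventually (gt_mem_nhds hε)] with N hN ρ hρ
    rw [dist_eq_norm, hD]
    refine (norm_inner_le_norm _ _).trans_lt (lt_of_le_of_lt ?_ hN)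
    gcongr
    exact (hC ρ hρ).trans (le_abs_self C)
  obtain ⟨C, hC⟩ := hB
  have hΦr : Continuous fun ρ : ℝ => Φ ρ := hΦ.comp Complex.continuous_ofReal
  have hmem : ∀ v : E, MemLp (fun ρ : ℝ => inner ℂ v (Φ ρ)) 2 volume := fun v =>
    ⟨(by fun_prop : Continuous _).aestronglyMeasurable,
      (hC v).trans_lt (ENNReal.mul_lt_top ENNReal.coe_lt_top enorm_lt_top)⟩
  refine ⟨fun A hA => ?_, habs, ?_, fun n => ?_, ?_, ?_⟩
  · obtain ⟨C, hC⟩ := hA.exists_bound_of_continuousOn hΦ.continuousOn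
    exact hbd A C hC
  · rw [← tendstoUniformlyOn_univ]
    have := (hbd (Set.range ((↑) : ℝ → ℂ)) M (by rintro _ ⟨ρ, rfl⟩; exact hM ρ)).comp
      ((↑) : ℝ → ℂ)
    simpa [Function.comp_def] using this
  · have e : (fun ρ : ℝ => u n (ρ : ℂ)) = fun ρ : ℝ => inner ℂ (K (n + 1) - K n) (Φ ρ) := by
      funext ρ
      rw [inner_sub_left, ← hS, ← hS, Finset.sum_range_succ]
      ring
    rw [e]
    exact hmem _
  · simp only [hF]
    exact hmem k
  · simp only [hD]
    have h0 : Tendsto (fun N => (C : ENNReal) * ‖k - K N‖ₑ) atTop (𝓝 0) := by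
      have h1 := ENNReal.tendsto_ofReal hKlim
      simp only [ofReal_norm, ENNReal.ofReal_zero] at h1
      simpa using ENNReal.Tendsto.const_mul h1 (Or.inr ENNReal.coe_ne_top)
    exact tendsto_of_tendsto_of_tendsto_of_le_of_le tendsto_const_nhds h0 (fun N => zero_le)
      fun N => hC _

end Hilbert

/-! ### Exponentials in `L₂(-l, l)`, seen as a circle of length `2l`. -/

section Circle

variable (l : ℝ) [Fact (0 < 2 * l)]

theorem memLp_liftIoc_of_continuous (f : C(ℝ, ℂ)) :
    MemLp (AddCircle.liftIoc (2 * l) (-l) f) 2 (@AddCircle.haarAddCircle (2 * l) _) :=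
  memLp_haarAddCircle_iff.2 (memLp_restrict_of_continuous f.continuous 2 _ _).memLp_liftIoc

/-- The restriction to `(-l, l]` of a continuous function, as a vector of `L₂`. -/
def circleLift : C(ℝ, ℂ) →ₗ[ℂ] Lp ℂ 2 (@AddCircle.haarAddCircle (2 * l) _) where
  toFun f := MemLp.toLp (AddCircle.liftIoc (2 * l) (-l) f)
    (memLp_liftIoc_of_continuous l f)
  map_add' _ _ := rfl
  map_smul' _ _ := rfl

/-- The factor `(2l)⁻¹` appears because Haar measure on the circle has total mass one. -/
theorem inner_circleLift (f g : C(ℝ, ℂ)) :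
    (inner ℂ (circleLift l f) (circleLift l g) : ℂ)
      = (2 * l : ℂ)⁻¹ * ∫ t in (-l)..l, (starRingEnd ℂ) (f t) * g t := by
  rw [MeasureTheory.L2.inner_def]
  have h1 : ∀ f : C(ℝ, ℂ), circleLift l f
      =ᵐ[AddCircle.haarAddCircle] AddCircle.liftIoc (2 * l) (-l) f := fun f =>
    MemLp.coeFn_toLp (memLp_liftIoc_of_continuous l f)
  have h2 : ∫ z, inner ℂ (circleLift l f z) (circleLift l g z) ∂AddCircle.haarAddCircle
      = ∫ z, AddCircle.liftIoc (2 * l) (-l) (fun t => (starRingEnd ℂ) (f t) * g t) z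
          ∂AddCircle.haarAddCircle := by
    refine integral_congr_ae ?_
    filter_upwards [h1 f, h1 g] with z hf hg
    rw [hf, hg, RCLike.inner_apply']
    rfl
  rw [h2, AddCircle.integral_haarAddCircle, AddCircle.integral_liftIoc_eq_intervalIntegral,
    show -l + 2 * l = l by ring, Complex.real_smul]
  push_cast
  rfl

theorem norm_circleLift_sq (f : C(ℝ, ℂ)) :
    ‖circleLift l f‖ ^ 2 = (2 * l)⁻¹ * ∫ t in (-l)..l, ‖f t‖ ^ 2 := by
  have h := inner_circleLift l f f
  rw [inner_self_eq_norm_sq_to_K] at h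
  have e : ∫ t in (-l)..l, (starRingEnd ℂ) (f t) * f t
      = ((∫ t in (-l)..l, ‖f t‖ ^ 2 : ℝ) : ℂ) := by
    rw [← intervalIntegral.integral_ofReal]
    refine intervalIntegral.integral_congr fun t _ => ?_
    rw [Complex.conj_mul']
    push_cast
    rfl
  rw [e] at h
  refine Complex.ofReal_injective ?_
  push_cast at h ⊢
  exact h

theorem continuous_circleLift {X : Type*} [TopologicalSpace X] [FirstCountableTopology X]
    {φ : X → C(ℝ, ℂ)} (hφ : Continuous fun z : X × ℝ => φ z.1 z.2) :
    Continuous fun x => circleLift l (φ x) := by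
  rw [continuous_iff_continuousAt]
  intro x
  rw [ContinuousAt, tendsto_iff_norm_sub_tendsto_zero]
  have h1 : Continuous fun y : X => ∫ t in (-l)..l, ‖φ y t - φ x t‖ ^ 2 := by
    refine intervalIntegral.continuous_parametric_intervalIntegral_of_continuous' ?_ _ _
    exact ((hφ.sub ((φ x).continuous.comp continuous_snd)).norm).pow 2
  have h2 := ((continuous_const.mul h1).sqrt (f := fun y : X => (2 * l)⁻¹ * _)).tendsto x
  have h3 : ∀ y, ‖circleLift l (φ y) - circleLift l (φ x)‖
      = √((2 * l)⁻¹ * ∫ t in (-l)..l, ‖φ y t - φ x t‖ ^ 2) := by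
    intro y
    rw [← map_sub, ← Real.sqrt_sq (norm_nonneg _), norm_circleLift_sq]
    rfl
  simp only [h3]
  simpa using h2

end Circle

theorem nsinc_neg (z : ℂ) : nsinc (-z) = nsinc z := by
  simp only [nsinc, neg_eq_zero, mul_neg, Complex.sin_neg, neg_div_neg_eq]

theorem nsinc_two_mul (z : ℂ) : nsinc (2 * z) = nsinc z * Complex.cos (Real.pi * z) := by
  have hpi : (Real.pi : ℂ) ≠ 0 := by exact_mod_cast Real.pi_ne_zero
  by_cases hz : z = 0
  · simp [nsinc, hz]
  · rw [nsinc, nsinc, if_neg hz, if_neg (mul_ne_zero two_ne_zero hz), mul_left_comm,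
      Complex.sin_two_mul]
    field_simp

theorem nsinc_intCast (m : ℤ) : nsinc m = if m = 0 then 1 else 0 := by
  split_ifs with h
  · simp [nsinc, h]
  · rw [nsinc, if_neg (by exact_mod_cast h), mul_comm, Complex.sin_int_mul_pi, zero_div]

theorem nsinc_mul_div_pi {w : ℂ} (hw : w ≠ 0) : nsinc (w / Real.pi) = Complex.sin w / w := by
  have hpi : (Real.pi : ℂ) ≠ 0 := by exact_mod_cast Real.pi_ne_zero
  rw [nsinc, if_neg (div_ne_zero hw hpi), mul_div_cancel₀ _ hpi]

/-- The exponential `t ↦ exp (i ρ t)`. -/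
def expMap (ρ : ℂ) : C(ℝ, ℂ) where
  toFun t := Complex.exp (Complex.I * ρ * t)

@[simp] theorem expMap_apply (ρ : ℂ) (t : ℝ) : expMap ρ t = Complex.exp (Complex.I * ρ * t) := rfl

section

variable (l : ℝ) [hl : Fact (0 < 2 * l)]

theorem half_period_pos : 0 < l := by linarith [hl.out]

theorem inner_expMap (a : ℝ) (ρ : ℂ) :
    (inner ℂ (circleLift l (expMap a)) (circleLift l (expMap ρ)) : ℂ)
      = nsinc ((ρ - a) * l / Real.pi) := by
  have hl' : (l : ℂ) ≠ 0 := by exact_mod_cast (half_period_pos l).ne'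
  rw [inner_circleLift]
  have e : ∀ t : ℝ, (starRingEnd ℂ) (expMap a t) * expMap ρ t
      = Complex.exp (Complex.I * (ρ - a) * t) := by
    intro t
    rw [expMap_apply, expMap_apply, ← Complex.exp_conj, ← Complex.exp_add]
    simp only [map_mul, Complex.conj_I, Complex.conj_ofReal]
    ring_nf
  simp only [e]
  by_cases h : ρ - a = 0
  · simp only [h, nsinc, mul_zero, zero_mul, Complex.exp_zero, zero_div, if_true,
      intervalIntegral.integral_const, Complex.real_smul]
    push_cast
    field_simp
    ring
  · rw [integral_exp_mul_complex (mul_ne_zero Complex.I_ne_zero h),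
      nsinc_mul_div_pi (mul_ne_zero h hl'), Complex.sin]
    have e1 : Complex.I * (ρ - a) * (l : ℂ) = (ρ - a) * l * Complex.I := by ring
    have e2 : Complex.I * (ρ - a) * ((-l : ℝ) : ℂ) = -((ρ - a) * l) * Complex.I := by
      push_cast; ring
    rw [e1, e2]
    field_simp
    rw [Complex.I_sq]
    ring

theorem fourierBasis_eq (n : ℤ) :
    fourierBasis (T := 2 * l) n = circleLift l (expMap ((n * Real.pi / l : ℝ) : ℂ)) := by
  rw [coe_fourierBasis]
  have hl' : (l : ℂ) ≠ 0 := by exact_mod_cast (half_period_pos l).ne'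
  have e : AddCircle.liftIoc (2 * l) (-l) (expMap ((n * Real.pi / l : ℝ) : ℂ))
      = fourier (T := 2 * l) n := by
    funext z
    rw [← (AddCircle.equivIoc (2 * l) (-l)).symm_apply_apply z]
    obtain ⟨t, ht⟩ := AddCircle.equivIoc (2 * l) (-l) z
    change AddCircle.liftIoc (2 * l) (-l) _ (t : AddCircle (2 * l)) = fourier n (t : AddCircle _)
    rw [AddCircle.liftIoc_coe_apply ht, fourier_coe_apply, expMap_apply]
    congr 1
    push_cast
    field_simp
  refine Lp.ext ((coeFn_fourierLp 2 n).trans ?_)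
  rw [← e]
  exact (MemLp.coeFn_toLp (memLp_liftIoc_of_continuous l _)).symm

theorem continuous_circleLift_expMap : Continuous fun ρ : ℂ => circleLift l (expMap ρ) :=
  continuous_circleLift l (by simp only [expMap_apply]; fun_prop)

/-- A shift of all frequencies preserves orthonormality. The index set and the form `-g + a` fit the
tiling of `ℝ` in `isBessel_expMap`. -/
theorem orthonormal_expMap (a : ℝ) : Orthonormal ℂ fun g : AddSubgroup.zmultiples (Real.pi / l) =>
    circleLift l (expMap ((-(g : ℝ) + a : ℝ) : ℂ)) := by
  classical
  have hl' : (l : ℂ) ≠ 0 := by exact_mod_cast (half_period_pos l).ne'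
  have hpi : (Real.pi : ℂ) ≠ 0 := by exact_mod_cast Real.pi_ne_zero
  rw [orthonormal_iff_ite]
  rintro ⟨_, m, rfl⟩ ⟨_, n, rfl⟩
  rw [inner_expMap]
  have e : ((((-((fun k : ℤ => k • (Real.pi / l)) n) + a : ℝ) : ℂ))
      - ((-((fun k : ℤ => k • (Real.pi / l)) m) + a : ℝ) : ℂ)) * l / Real.pi
      = ((m - n : ℤ) : ℂ) := by
    push_cast [zsmul_eq_mul]
    field_simp
    ring
  rw [e, nsinc_intCast]
  have hinj : Function.Injective fun k : ℤ => k • (Real.pi / l) :=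
    (zsmul_left_strictMono (div_pos Real.pi_pos (half_period_pos l))).injective
  simp only [sub_eq_zero]
  congr 1
  exact propext ⟨fun h => by rw [h], fun h => hinj (Subtype.ext_iff.1 h)⟩

/-- Plancherel's inequality for functions supported in `[-l, l]`. -/
theorem isBessel_expMap : IsBessel fun ρ : ℝ => circleLift l (expMap ρ) := by
  have hc : 0 < Real.pi / l := div_pos Real.pi_pos (half_period_pos l)
  have hcont : Continuous fun ρ : ℝ => circleLift l (expMap ρ) :=
    (continuous_circleLift_expMap l).comp Complex.continuous_ofReal
  -- Cut `ℝ` into cells of length `π/l`; by Bessel's inequality the sum over the cells is at most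
  -- `‖k‖²` at each point of one cell. The constant is the square root of the length of a cell.
  refine ⟨(Real.pi / l).toNNReal ^ (1 / 2 : ℝ), fun k => ?_⟩
  have hsum : ∀ θ : ℝ, ∑' g : AddSubgroup.zmultiples (Real.pi / l),
      ‖inner ℂ k (circleLift l (expMap ((-(g : ℝ) + θ : ℝ) : ℂ)))‖ₑ ^ (2 : ℝ)
        ≤ ‖k‖ₑ ^ (2 : ℝ) := by
    intro θ
    have h1 := (orthonormal_expMap l θ).tsum_inner_products_le (x := k)
    have h2 := (orthonormal_expMap l θ).inner_products_summable (x := k)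
    have h3 := ENNReal.ofReal_le_ofReal h1
    rw [ENNReal.ofReal_tsum_of_nonneg (fun _ => by positivity) h2] at h3
    simp only [ENNReal.ofReal_pow (norm_nonneg _), ofReal_norm] at h3
    simp only [ENNReal.rpow_two]
    refine le_trans (le_of_eq (tsum_congr fun g => ?_)) h3
    rw [← ofReal_norm, ← ofReal_norm, norm_inner_symm]
  have hmeas : ∀ g : ℝ, Measurable fun θ : ℝ =>
      ‖(inner ℂ k (circleLift l (expMap ((-g + θ : ℝ) : ℂ))) : ℂ)‖ₑ ^ (2 : ℝ) := by
    intro g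
    have : Continuous fun θ : ℝ => (inner ℂ k (circleLift l (expMap ((-g + θ : ℝ) : ℂ))) : ℂ) :=
      continuous_const.inner (hcont.comp (by fun_prop : Continuous fun θ : ℝ => -g + θ))
    exact this.measurable.enorm.pow_const _
  have hint : ∫⁻ ρ : ℝ, ‖(inner ℂ k (circleLift l (expMap (ρ : ℂ))) : ℂ)‖ₑ ^ (2 : ℝ)
      ≤ ENNReal.ofReal (Real.pi / l) * ‖k‖ₑ ^ (2 : ℝ) := by
    rw [(isAddFundamentalDomain_Ioc hc 0 volume).lintegral_eq_tsum'
      (fun ρ : ℝ => ‖(inner ℂ k (circleLift l (expMap (ρ : ℂ))) : ℂ)‖ₑ ^ (2 : ℝ))]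
    have e : ∀ (g : AddSubgroup.zmultiples (Real.pi / l)) (θ : ℝ),
        (-g +ᵥ θ : ℝ) = -(g : ℝ) + θ := fun g θ => rfl
    simp only [e]
    rw [← lintegral_tsum fun g : AddSubgroup.zmultiples (Real.pi / l) => (hmeas g).aemeasurable]
    refine (lintegral_mono hsum).trans (le_of_eq ?_)
    rw [setLIntegral_const, Real.volume_Ioc, mul_comm]
    simp
  rw [eLpNorm_eq_lintegral_rpow_enorm_toReal two_ne_zero ENNReal.ofNat_ne_top]
  simp only [ENNReal.toReal_ofNat]
  refine (ENNReal.rpow_le_rpow hint (by simp)).trans ?_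
  rw [ENNReal.mul_rpow_of_nonneg _ _ (by simp), ← ENNReal.rpow_mul]
  simp only [one_div, isUnit_iff_ne_zero, ne_eq, OfNat.ofNat_ne_zero,
    not_false_eq_true, IsUnit.mul_inv_cancel, ENNReal.rpow_one]
  gcongr
  rw [ENNReal.coe_rpow_of_nonneg _ (by positivity)]
  rfl

/-- Representation of a bounded functional of superpositions of the functions `g ρ` on
`[-l, l]`. -/
theorem exists_kernel {φ : ℂ → C(ℝ, ℂ)} {g : ℂ → ℝ → ℂ} {e : ℝ → ℂ} (he : ∀ v, ‖e v‖ = 1)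
    (hφ : ∀ ρ v, φ ρ v = e v * g ρ v) {F : ℂ → ℂ} {C : ℝ}
    (h : ∀ σ : ℂ →₀ ℂ, ‖∑ ρ ∈ σ.support, σ ρ * F ρ‖
      ≤ C * √(∫ v in (-l)..l, ‖∑ ρ ∈ σ.support, σ ρ * g ρ v‖ ^ 2)) :
    ∃ k : Lp ℂ 2 (@AddCircle.haarAddCircle (2 * l) _),
      ∀ ρ, F ρ = inner ℂ k (circleLift l (φ ρ)) := by
  -- The factor `√(2l)` compensates the normalization of Haar measure; the factor `e`, of modulus
  -- one, does not affect the norm.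
  refine exists_inner_eq_of_bound (fun ρ => circleLift l (φ ρ)) F (C * √(2 * l)) fun σ => ?_
  refine (h σ).trans (le_of_eq ?_)
  have e1 : ∑ ρ ∈ σ.support, σ ρ • circleLift l (φ ρ)
      = circleLift l (∑ ρ ∈ σ.support, σ ρ • φ ρ) := by
    rw [map_sum]
    exact Finset.sum_congr rfl fun ρ _ => (map_smul _ _ _).symm
  have e2 : ∀ v, ‖(∑ ρ ∈ σ.support, σ ρ • φ ρ) v‖ = ‖∑ ρ ∈ σ.support, σ ρ * g ρ v‖ := by
    intro v
    rw [ContinuousMap.sum_apply]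
    simp only [ContinuousMap.smul_apply, hφ, smul_eq_mul]
    rw [Finset.sum_congr rfl fun ρ _ => mul_left_comm (σ ρ) (e v) (g ρ v), ← Finset.mul_sum,
      norm_mul, he, one_mul]
  rw [e1, ← Real.sqrt_sq (norm_nonneg (circleLift l _)), norm_circleLift_sq, mul_assoc,
    ← Real.sqrt_mul hl.out.le, mul_inv_cancel_left₀ hl.out.ne']
  simp only [e2]

theorem norm_circleLift_sq_le {f : C(ℝ, ℂ)} {M : ℝ} (h : ∀ t ∈ Set.Icc (-l) l, ‖f t‖ ^ 2 ≤ M) :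
    ‖circleLift l f‖ ^ 2 ≤ M := by
  have hl0 := half_period_pos l
  rw [norm_circleLift_sq, inv_mul_le_iff₀ hl.out]
  have : ∫ t in (-l)..l, ‖f t‖ ^ 2 ≤ ∫ _ in (-l)..l, M := intervalIntegral.integral_mono_on
    (by linarith) ((f.continuous.norm.pow 2).intervalIntegrable _ _)
    _root_.intervalIntegrable_const h
  rw [intervalIntegral.integral_const, smul_eq_mul] at this
  linarith

end

/-! ### Cosine and twisted sine transforms; the even cardinal series. -/

/-- The function `t ↦ cos (ρ t)`. -/
def cosMap (ρ : ℂ) : C(ℝ, ℂ) where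
  toFun t := Complex.cos (ρ * t)

/-- The function `t ↦ exp (-i θ t) sin (ρ t) / ρ`. -/
def twistedSinMap (θ : ℝ) (ρ : ℂ) : C(ℝ, ℂ) where
  toFun t := Complex.exp (-(Complex.I * θ * t)) * sinDiv t ρ
  continuous_toFun := (by fun_prop : Continuous fun t : ℝ => Complex.exp (-(Complex.I * θ * t))).mul
    (continuous_sinDiv.comp (by fun_prop : Continuous fun t : ℝ => (t, ρ)))

theorem cosMap_eq (ρ : ℂ) : cosMap ρ = (1 / 2 : ℂ) • (expMap ρ + expMap (-ρ)) := by
  ext t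
  change Complex.cos (ρ * t) = (1 / 2 : ℂ) * (Complex.exp (Complex.I * ρ * t)
    + Complex.exp (Complex.I * (-ρ) * t))
  rw [Complex.cos]
  ring_nf

theorem smul_twistedSinMap_eq (θ : ℝ) (ρ : ℂ) :
    ρ • twistedSinMap θ ρ
      = (2 * Complex.I)⁻¹ • (expMap (ρ - θ) - expMap (-ρ - θ)) := by
  ext t
  change ρ * (Complex.exp (-(Complex.I * θ * t)) * sinDiv t ρ) = (2 * Complex.I)⁻¹
    * (Complex.exp (Complex.I * (ρ - θ) * t) - Complex.exp (Complex.I * (-ρ - θ) * t))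
  have e1 : Complex.exp (Complex.I * (ρ - θ) * t)
      = Complex.exp (-(Complex.I * θ * t)) * Complex.exp (ρ * t * Complex.I) := by
    rw [← Complex.exp_add]; ring_nf
  have e2 : Complex.exp (Complex.I * (-ρ - θ) * t)
      = Complex.exp (-(Complex.I * θ * t)) * Complex.exp (-(ρ * t) * Complex.I) := by
    rw [← Complex.exp_add]; ring_nf
  rw [mul_left_comm, mul_sinDiv, e1, e2, Complex.sin]
  field_simp
  rw [Complex.I_sq]
  ring

theorem norm_twistedSinMap_apply (θ : ℝ) (ρ : ℂ) (t : ℝ) :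
    ‖twistedSinMap θ ρ t‖ = ‖sinDiv t ρ‖ := by
  change ‖Complex.exp (-(Complex.I * θ * t)) * sinDiv t ρ‖ = _
  rw [norm_mul, show -(Complex.I * θ * t) = ((-(θ * t) : ℝ) : ℂ) * Complex.I by push_cast; ring,
    Complex.norm_exp_ofReal_mul_I, one_mul]

theorem norm_mul_sinDiv_le (t ρ : ℝ) : ‖(ρ : ℂ) * sinDiv t ρ‖ ≤ 1 := by
  rw [mul_sinDiv, ← Complex.ofReal_mul, ← Complex.ofReal_sin, Complex.norm_real]
  exact Real.abs_sin_le_one _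

theorem norm_sinDiv_le (t ρ : ℝ) : ‖sinDiv t ρ‖ ≤ |t| := by
  by_cases hρ : ρ = 0
  · simp [sinDiv, hρ]
  · have hρ' : 0 < ‖(ρ : ℂ)‖ := by simpa using hρ
    refine le_of_mul_le_mul_left ?_ hρ'
    rw [← norm_mul, mul_sinDiv, ← Complex.ofReal_mul, ← Complex.ofReal_sin, Complex.norm_real,
      Complex.norm_real, Real.norm_eq_abs, Real.norm_eq_abs, ← abs_mul]
    exact Real.abs_sin_le_abs

section

variable (l : ℝ) [hl : Fact (0 < 2 * l)]

theorem continuous_circleLift_cosMap : Continuous fun ρ : ℂ => circleLift l (cosMap ρ) :=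
  continuous_circleLift l
    (by fun_prop : Continuous fun z : ℂ × ℝ => Complex.cos (z.1 * (z.2 : ℂ)))

theorem continuous_circleLift_twistedSinMap (θ : ℝ) :
    Continuous fun ρ : ℂ => circleLift l (twistedSinMap θ ρ) :=
  continuous_circleLift l
    ((by fun_prop : Continuous fun z : ℂ × ℝ => Complex.exp (-(Complex.I * θ * (z.2 : ℂ)))).mul
      (continuous_sinDiv.comp (by fun_prop : Continuous fun z : ℂ × ℝ => (z.2, z.1))))

theorem isBessel_cosMap : IsBessel fun ρ : ℝ => circleLift l (cosMap ρ) := by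
  have h := isBessel_expMap l
  have hc : Continuous fun ρ : ℝ => circleLift l (expMap ρ) :=
    (continuous_circleLift_expMap l).comp Complex.continuous_ofReal
  have h2 := h.add (h.comp hc (Measure.measurePreserving_neg volume)) hc (hc.comp continuous_neg)
  refine h2.mono (M := 1) fun k ρ => ?_
  rw [cosMap_eq, map_smul, map_add, inner_smul_right, norm_mul, Complex.ofReal_neg]
  gcongr
  norm_num

theorem isBessel_smul_twistedSinMap (θ : ℝ) :
    IsBessel fun ρ : ℝ => (ρ : ℂ) • circleLift l (twistedSinMap θ ρ) := by
  have h := isBessel_expMap l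
  have hc : Continuous fun ρ : ℝ => circleLift l (expMap ρ) :=
    (continuous_circleLift_expMap l).comp Complex.continuous_ofReal
  have m1 : MeasurePreserving (fun ρ : ℝ => ρ - θ) volume volume :=
    measurePreserving_sub_right volume θ
  have m2 : MeasurePreserving (fun ρ : ℝ => -ρ - θ) volume volume :=
    m1.comp (Measure.measurePreserving_neg volume)
  have c1 : Continuous fun ρ : ℝ => circleLift l (expMap ((ρ - θ : ℝ) : ℂ)) :=
    hc.comp (by fun_prop : Continuous fun ρ : ℝ => ρ - θ)
  have c2 : Continuous fun ρ : ℝ => -circleLift l (expMap ((-ρ - θ : ℝ) : ℂ)) :=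
    (hc.comp (by fun_prop : Continuous fun ρ : ℝ => -ρ - θ)).neg
  have h3 : IsBessel fun ρ : ℝ => -circleLift l (expMap ((-ρ - θ : ℝ) : ℂ)) :=
    (h.comp hc m2).mono (M := 1) fun k ρ => by simp [inner_neg_right]
  refine ((h.comp hc m1).add h3 c1 c2).mono (M := 1) fun k ρ => ?_
  rw [← map_smul, smul_twistedSinMap_eq, map_smul, map_sub, inner_smul_right, norm_mul,
    ← sub_eq_add_neg]
  push_cast
  gcongr
  simp
  norm_num

/-- For real `ρ`, `|sin(ρt)/ρ|` is at most `l` on `[-l, l]` and at most `1/|ρ|`; together these give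
decay like `(1 + ρ²)⁻¹` for the square. -/
theorem isBessel_twistedSinMap (θ : ℝ) :
    IsBessel fun ρ : ℝ => circleLift l (twistedSinMap θ ρ) := by
  refine isBessel_of_norm_le (M := 1 + l ^ 2) (by positivity) fun ρ =>
    norm_circleLift_sq_le l fun t ht => ?_
  rw [norm_twistedSinMap_apply, ← div_eq_mul_inv, le_div_iff₀ (by positivity)]
  have h1 : ‖sinDiv t ρ‖ ≤ l := (norm_sinDiv_le t ρ).trans (abs_le.2 ht)
  have h2 : (‖(ρ : ℂ)‖ * ‖sinDiv t ρ‖) ^ 2 ≤ 1 ^ 2 := by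
    rw [← norm_mul]
    exact pow_le_pow_left₀ (norm_nonneg _) (norm_mul_sinDiv_le t ρ) 2
  have h3 : ‖sinDiv t ρ‖ ^ 2 ≤ l ^ 2 := pow_le_pow_left₀ (norm_nonneg _) h1 2
  rw [Complex.norm_real, mul_pow, Real.norm_eq_abs, sq_abs] at h2
  linarith

theorem norm_circleLift_twistedSinMap_le (θ ρ : ℝ) :
    ‖circleLift l (twistedSinMap θ ρ)‖ ≤ l := by
  refine le_of_pow_le_pow_left₀ two_ne_zero (half_period_pos l).le ?_
  refine norm_circleLift_sq_le l fun t ht => ?_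
  rw [norm_twistedSinMap_apply]
  exact pow_le_pow_left₀ (norm_nonneg _) ((norm_sinDiv_le t ρ).trans (abs_le.2 ht)) 2

theorem norm_smul_circleLift_twistedSinMap_le (θ ρ : ℝ) :
    ‖(ρ : ℂ) • circleLift l (twistedSinMap θ ρ)‖ ≤ 1 := by
  rw [← map_smul]
  refine le_of_pow_le_pow_left₀ two_ne_zero zero_le_one ?_
  rw [one_pow]
  refine norm_circleLift_sq_le l fun t ht => ?_
  rw [ContinuousMap.smul_apply, norm_smul, norm_twistedSinMap_apply, ← norm_mul]
  exact pow_le_one₀ (norm_nonneg _) (norm_mul_sinDiv_le t ρ)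

theorem norm_circleLift_cosMap_le (ρ : ℝ) : ‖circleLift l (cosMap ρ)‖ ≤ 1 := by
  refine le_of_pow_le_pow_left₀ two_ne_zero zero_le_one ?_
  rw [one_pow]
  refine norm_circleLift_sq_le l fun t ht => ?_
  refine pow_le_one₀ (norm_nonneg _) ?_
  change ‖Complex.cos (ρ * t)‖ ≤ 1
  rw [← Complex.ofReal_mul, ← Complex.ofReal_cos, Complex.norm_real]
  exact Real.abs_cos_le_one _

theorem inner_fourierBasis_cosMap (n : ℤ) (ρ : ℂ) :
    (inner ℂ (fourierBasis (T := 2 * l) n) (circleLift l (cosMap ρ)) : ℂ)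
      = 1 / 2 * (nsinc (ρ * l / Real.pi - n) + nsinc (ρ * l / Real.pi + n)) := by
  have hl' : (l : ℂ) ≠ 0 := by exact_mod_cast (half_period_pos l).ne'
  have hpi : (Real.pi : ℂ) ≠ 0 := by exact_mod_cast Real.pi_ne_zero
  rw [fourierBasis_eq, cosMap_eq, map_smul, map_add, inner_smul_right, inner_add_right,
    inner_expMap, inner_expMap]
  congr 2
  · congr 1
    push_cast
    field_simp
  · rw [← nsinc_neg]
    congr 1
    push_cast
    field_simp
    ring

/-- The cardinal series of a cosine transform. -/
theorem seriesConverges_evenPair (k : Lp ℂ 2 (@AddCircle.haarAddCircle (2 * l) _)) {F : ℂ → ℂ}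
    (hF : ∀ ρ, F ρ = inner ℂ k (circleLift l (cosMap ρ))) {c : ℕ → ℂ} (hc0 : c 0 = F 0 / 2)
    (hc : ∀ n : ℕ, n ≠ 0 → c n = F (n * Real.pi / l)) :
    SeriesConverges (fun n ρ => c n * evenPair (-l) n ρ) F := by
  set a : ℂ → ℤ → ℂ := fun ρ i => inner ℂ k (fourierBasis (T := 2 * l) i)
    * inner ℂ (fourierBasis (T := 2 * l) i) (circleLift l (cosMap ρ)) with ha
  have hpair : ∀ (n : ℕ) (ρ : ℂ), evenPair (-l) n ρ
      = nsinc (ρ * l / Real.pi - n) + nsinc (ρ * l / Real.pi + n) := by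
    intro n ρ
    rw [evenPair, add_comm, ← nsinc_neg, ← nsinc_neg (_ - _)]
    push_cast
    congr 2 <;> ring
  have hFn : ∀ n : ℕ, F (n * Real.pi / l) = 1 / 2 * (inner ℂ k (fourierBasis (T := 2 * l) n)
      + inner ℂ k (fourierBasis (T := 2 * l) (-n))) := by
    intro n
    rw [hF, cosMap_eq, map_smul, map_add, inner_smul_right, inner_add_right, fourierBasis_eq,
      fourierBasis_eq]
    push_cast
    rw [neg_mul, neg_div]
  -- At `n = 0` the two members of the pair coincide and only one basis vector is involved, hence
  -- the halved coefficient.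
  have hu0 : ∀ ρ, c 0 * evenPair (-l) 0 ρ = a ρ 0 := by
    intro ρ
    have h0 := hFn 0
    simp only [Nat.cast_zero, zero_mul, zero_div, neg_zero, ← two_mul] at h0
    simp only [ha, inner_fourierBasis_cosMap, hpair, hc0, h0]
    push_cast
    ring
  have hun : ∀ (n : ℕ) ρ, n ≠ 0 → c n * evenPair (-l) n ρ = a ρ n + a ρ (-n) := by
    intro n ρ hn
    simp only [ha, inner_fourierBasis_cosMap, hpair, hc n hn, hFn]
    push_cast
    ring_nf
  -- The pairs `±n` with `n < N` exhaust the integers of absolute value less than `N`.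
  have hs : Tendsto (fun N : ℕ => Finset.Ioo (-(N : ℤ)) N) atTop atTop := by
    refine tendsto_atTop_finset_of_monotone (fun M N h => ?_) fun i => ⟨i.natAbs + 1, ?_⟩
    · exact Finset.Ioo_subset_Ioo (by omega) (by omega)
    · rw [Finset.mem_Ioo]; omega
  refine seriesConverges_of_hilbertBasis fourierBasis hs (continuous_circleLift_cosMap l)
    (norm_circleLift_cosMap_le l) (isBessel_cosMap l) k hF (fun N ρ => ?_) fun ρ => ?_
  · change _ = ∑ i ∈ Finset.Ioo (-(N : ℤ)) N, a ρ i
    induction N with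
    | zero => simp
    | succ N ih =>
      rw [Finset.sum_range_succ, ih]
      rcases Nat.eq_zero_or_pos N with rfl | hN
      · rw [hu0]
        have : Finset.Ioo (-((0 + 1 : ℕ) : ℤ)) ((0 + 1 : ℕ) : ℤ) = {0} := by decide
        rw [this]
        simp
      · have e : Finset.Ioo (-((N + 1 : ℕ) : ℤ)) ((N + 1 : ℕ) : ℤ)
            = insert (N : ℤ) (insert (-(N : ℤ)) (Finset.Ioo (-(N : ℤ)) N)) := by
          ext i
          simp only [Finset.mem_Ioo, Finset.mem_insert]
          omega
        rw [hun N ρ hN.ne', e, Finset.sum_insert, Finset.sum_insert]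
        · ring
        · simp
        · simp only [Finset.mem_insert, Finset.mem_Ioo]
          omega
  · have h := (fourierBasis.summable_inner_mul_inner k (circleLift l (cosMap ρ))).norm
    have h1 := h.comp_injective (Nat.cast_injective (R := ℤ))
    have h2 := h.comp_injective (neg_injective.comp (Nat.cast_injective (R := ℤ)))
    refine Summable.of_nonneg_of_le (fun n => norm_nonneg _) (fun n => ?_) (h1.add h2)
    rcases Nat.eq_zero_or_pos n with rfl | hn
    · rw [hu0]
      exact le_add_of_nonneg_right (norm_nonneg _)
    · rw [hun n ρ hn.ne']
      exact norm_add_le _ _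

end

/-! ### The odd cardinal series. -/

theorem complex_cos_nat_mul_pi (n : ℕ) : Complex.cos (n * Real.pi) = (-1) ^ n := by
  have := Real.cos_nat_mul_pi n
  rw [← Complex.ofReal_inj] at this
  push_cast at this
  exact this

/-- After `nsinc_two_mul`, the half-integer shift turns both cosines into `±(-1)^n sin(ρl)`, so the
divisor `sin(ρl)` factors out. -/
theorem oddPair_eq (l : ℝ) (n : ℕ) (ρ : ℂ) :
    oddPair l n ρ = (-1) ^ n * Complex.sin (ρ * l)
      * (nsinc (ρ * l / Real.pi - 1 / 2 - n) - nsinc (ρ * l / Real.pi + 1 / 2 + n)) := by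
  have hpi : (Real.pi : ℂ) ≠ 0 := by exact_mod_cast Real.pi_ne_zero
  have h1 : Complex.cos (Real.pi * (ρ * l / Real.pi - 1 / 2 - n))
      = (-1) ^ n * Complex.sin (ρ * l) := by
    have e : Real.pi * (ρ * l / Real.pi - 1 / 2 - n) = ρ * l - n * Real.pi - Real.pi / 2 := by
      field_simp
      ring
    rw [e, Complex.cos_sub_pi_div_two, Complex.sin_sub, complex_cos_nat_mul_pi,
      Complex.sin_nat_mul_pi]
    ring
  have h2 : Complex.cos (Real.pi * (ρ * l / Real.pi + 1 / 2 + n))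
      = -((-1) ^ n * Complex.sin (ρ * l)) := by
    have e : Real.pi * (ρ * l / Real.pi + 1 / 2 + n) = ρ * l + n * Real.pi + Real.pi / 2 := by
      field_simp
      ring
    rw [e, Complex.cos_add_pi_div_two, Complex.sin_add, complex_cos_nat_mul_pi,
      Complex.sin_nat_mul_pi]
    ring
  have e1 : 2 * ρ * l / Real.pi - 2 * n - 1 = 2 * (ρ * l / Real.pi - 1 / 2 - n) := by ring
  have e2 : 2 * ρ * l / Real.pi + 2 * n + 1 = 2 * (ρ * l / Real.pi + 1 / 2 + n) := by ring
  rw [oddPair, e1, e2, nsinc_two_mul, nsinc_two_mul, h1, h2]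
  ring

section

variable (l : ℝ) [hl : Fact (0 < 2 * l)]

/-- The Fourier coefficients of the twisted sine. -/
def sinCoeff (m : ℤ) (ρ : ℂ) : ℂ :=
  inner ℂ (fourierBasis (T := 2 * l) m) (circleLift l (twistedSinMap (Real.pi / (2 * l)) ρ))

theorem continuous_sinCoeff (m : ℤ) : Continuous (sinCoeff l m) :=
  continuous_const.inner (continuous_circleLift_twistedSinMap l _)

theorem mul_sinCoeff (m : ℤ) (ρ : ℂ) :
    ρ * sinCoeff l m ρ = (2 * Complex.I)⁻¹
      * (nsinc (ρ * l / Real.pi - 1 / 2 - m) - nsinc (ρ * l / Real.pi + 1 / 2 + m)) := by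
  have hl' : (l : ℂ) ≠ 0 := by exact_mod_cast (half_period_pos l).ne'
  have hpi : (Real.pi : ℂ) ≠ 0 := by exact_mod_cast Real.pi_ne_zero
  rw [sinCoeff, ← inner_smul_right, ← map_smul, smul_twistedSinMap_eq, map_smul, map_sub,
    inner_smul_right, inner_sub_right, fourierBasis_eq, inner_expMap, inner_expMap]
  congr 2
  · congr 1
    push_cast
    field_simp
  · rw [← nsinc_neg]
    congr 1
    push_cast
    field_simp
    ring

/-- The twist shifts the frequency index to `m + 1/2`, and `m ↦ -m - 1` changes its sign; the sine
is odd. The proof compares the products with `ρ` and reaches `ρ = 0` by continuity. -/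
theorem sinCoeff_neg_sub_one (m : ℤ) (ρ : ℂ) : sinCoeff l (-m - 1) ρ = -sinCoeff l m ρ := by
  have h : sinCoeff l (-m - 1) = fun ρ => -sinCoeff l m ρ := by
    refine Continuous.ext_on (dense_compl_singleton (0 : ℂ)) (continuous_sinCoeff l _)
      (continuous_sinCoeff l _).neg fun ρ hρ => ?_
    refine mul_left_cancel₀ (show ρ ≠ 0 from hρ) ?_
    rw [mul_neg, mul_sinCoeff, mul_sinCoeff]
    push_cast
    ring_nf
  rw [h]

theorem oddPair_eq_mul_sinCoeff (n : ℕ) (ρ : ℂ) :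
    oddPair l n ρ
      = 2 * ρ * Complex.sin (ρ * l) * ((-1) ^ n * Complex.I * sinCoeff l n ρ) := by
  have h := mul_sinCoeff l n ρ
  rw [oddPair_eq]
  have e : (2 * Complex.I) * (2 * Complex.I)⁻¹ = 1 :=
    mul_inv_cancel₀ (mul_ne_zero two_ne_zero Complex.I_ne_zero)
  push_cast at h
  linear_combination (-2 * Complex.sin (ρ * l) * (-1) ^ n * Complex.I) * h
    - (Complex.sin (ρ * l) * (-1) ^ n
      * (nsinc (ρ * l / Real.pi - 1 / 2 - n) - nsinc (ρ * l / Real.pi + 1 / 2 + n))) * e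

/-- Identifies the filled-in quotient with an entire expression: both are limits of the same
quotient at each zero of the denominator. -/
theorem oddQuot_eq (n : ℕ) (ρ : ℂ) :
    oddQuot l n ρ = (-1) ^ n * Complex.I * sinCoeff l n ρ := by
  have hl0 := (half_period_pos l).ne'
  by_cases hD : 2 * ρ * Complex.sin (ρ * l) = 0
  · refine tendsto_nhds_unique (tendsto_oddQuot hl0 n ρ) ?_
    have hcont : Continuous fun z => (-1) ^ n * Complex.I * sinCoeff l n z :=
      continuous_const.mul (continuous_sinCoeff l n)
    have hs : Complex.sin (ρ * l) = 0 := by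
      rcases mul_eq_zero.1 hD with h | h
      · simp [show ρ = 0 by simpa using h]
      · exact h
    have hc : Complex.cos (ρ * l) ≠ 0 := by
      intro h
      have := Complex.sin_sq_add_cos_sq (ρ * l)
      simp [hs, h] at this
    have ev1 : ∀ᶠ z : ℂ in 𝓝[≠] ρ, z ≠ 0 := (hasDerivAt_id ρ).eventually_ne one_ne_zero
    have ev2 : ∀ᶠ z : ℂ in 𝓝[≠] ρ, Complex.sin (z * l) ≠ 0 := by
      have hd : HasDerivAt (fun z : ℂ => Complex.sin (z * l)) (Complex.cos (ρ * l) * (1 * l)) ρ :=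
        ((hasDerivAt_id ρ).mul_const (l : ℂ)).csin
      exact hd.eventually_ne (mul_ne_zero hc (by simpa using hl0))
    refine (hcont.continuousAt.tendsto.mono_left nhdsWithin_le_nhds).congr' ?_
    filter_upwards [ev1, ev2] with z h1 h2
    rw [oddPair_eq_mul_sinCoeff, mul_div_cancel_left₀ _ (mul_ne_zero (mul_ne_zero two_ne_zero h1) h2)]
  · rw [oddQuot, if_neg hD, oddPair_eq_mul_sinCoeff, mul_div_cancel_left₀ _ hD]

/-- The cardinal series of a sine transform, with a multiplier `m`. -/
theorem seriesConverges_oddQuot (k : Lp ℂ 2 (@AddCircle.haarAddCircle (2 * l) _)) {F m : ℂ → ℂ}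
    (hF : ∀ ρ, F ρ = inner ℂ k (circleLift l (twistedSinMap (Real.pi / (2 * l)) ρ)))
    (hm : Continuous m) {M : ℝ}
    (hM : ∀ ρ : ℝ, ‖m ρ • circleLift l (twistedSinMap (Real.pi / (2 * l)) ρ)‖ ≤ M)
    (hB : IsBessel fun ρ : ℝ => m ρ • circleLift l (twistedSinMap (Real.pi / (2 * l)) ρ))
    {c : ℕ → ℂ} (hc : ∀ n : ℕ, c n = (-1) ^ n * ((2 * n + 1) * Real.pi / l)
      * F ((2 * n + 1) / (2 * l) * Real.pi)) :
    SeriesConverges (fun n ρ => m ρ * (c n * oddQuot l n ρ)) (fun ρ => m ρ * F ρ) := by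
  have hl' : (l : ℂ) ≠ 0 := by exact_mod_cast (half_period_pos l).ne'
  set Φ : ℂ → Lp ℂ 2 (@AddCircle.haarAddCircle (2 * l) _) :=
    fun ρ => m ρ • circleLift l (twistedSinMap (Real.pi / (2 * l)) ρ) with hΦ
  set a : ℂ → ℤ → ℂ := fun ρ i => inner ℂ k (fourierBasis (T := 2 * l) i)
    * inner ℂ (fourierBasis (T := 2 * l) i) (Φ ρ) with ha
  have ha' : ∀ ρ i, a ρ i = inner ℂ k (fourierBasis (T := 2 * l) i) * (m ρ * sinCoeff l i ρ) := by
    intro ρ i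
    simp only [ha, hΦ, inner_smul_right, sinCoeff]
  have hFn : ∀ n : ℕ, (2 * n + 1) / (2 * l) * Real.pi * F ((2 * n + 1) / (2 * l) * Real.pi)
      = (2 * Complex.I)⁻¹ * (inner ℂ k (fourierBasis (T := 2 * l) n)
        - inner ℂ k (fourierBasis (T := 2 * l) (-n - 1))) := by
    intro n
    rw [hF, ← inner_smul_right, ← map_smul, smul_twistedSinMap_eq, map_smul, map_sub,
      inner_smul_right, inner_sub_right, fourierBasis_eq, fourierBasis_eq]
    congr 5
    · push_cast
      field_simp
      ring
    · push_cast
      field_simp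
      ring
  have hun : ∀ (n : ℕ) ρ, m ρ * (c n * oddQuot l n ρ) = a ρ n + a ρ (-n - 1) := by
    intro n ρ
    rw [ha', ha', sinCoeff_neg_sub_one, oddQuot_eq, hc]
    have e : (2 * Complex.I) * (2 * Complex.I)⁻¹ = 1 :=
      mul_inv_cancel₀ (mul_ne_zero two_ne_zero Complex.I_ne_zero)
    have e2 : ((-1 : ℂ) ^ n) * (-1) ^ n = 1 := by rw [← mul_pow]; simp
    have e3 : (2 * n + 1) * Real.pi / l = 2 * ((2 * n + 1) / (2 * l) * Real.pi : ℂ) := by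
      field_simp
    have h := hFn n
    rw [e3]
    linear_combination (2 * Complex.I * m ρ * sinCoeff l n ρ) * h
      + (m ρ * sinCoeff l n ρ * (inner ℂ k (fourierBasis (T := 2 * l) n)
        - inner ℂ k (fourierBasis (T := 2 * l) (-n - 1)))) * e
      + (m ρ * sinCoeff l n ρ * Complex.I * (2 * ((2 * n + 1) / (2 * l) * Real.pi : ℂ))
        * F ((2 * n + 1) / (2 * l) * Real.pi)) * e2
  -- The half-open interval is symmetric under the pairing of `n` with `-n - 1`.
  have hs : Tendsto (fun N : ℕ => Finset.Ico (-(N : ℤ)) N) atTop atTop := by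
    refine tendsto_atTop_finset_of_monotone (fun M N h => ?_) fun i => ⟨i.natAbs + 1, ?_⟩
    · exact Finset.Ico_subset_Ico (by omega) (by omega)
    · rw [Finset.mem_Ico]; omega
  refine seriesConverges_of_hilbertBasis (Φ := Φ) fourierBasis hs
    (hm.smul (continuous_circleLift_twistedSinMap l _)) hM hB k
    (fun ρ => by simp only [hΦ, inner_smul_right, hF]) (fun N ρ => ?_) fun ρ => ?_
  · change _ = ∑ i ∈ Finset.Ico (-(N : ℤ)) N, a ρ i
    induction N with
    | zero => simp
    | succ N ih =>
      have e : Finset.Ico (-((N + 1 : ℕ) : ℤ)) ((N + 1 : ℕ) : ℤ)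
          = insert (N : ℤ) (insert (-(N : ℤ) - 1) (Finset.Ico (-(N : ℤ)) N)) := by
        ext i
        simp only [Finset.mem_Ico, Finset.mem_insert]
        omega
      rw [Finset.sum_range_succ, ih, hun N ρ, e, Finset.sum_insert, Finset.sum_insert]
      · ring
      · simp
      · simp only [Finset.mem_insert, Finset.mem_Ico]
        omega
  · have h := (fourierBasis.summable_inner_mul_inner k (Φ ρ)).norm
    have h1 := h.comp_injective (Nat.cast_injective (R := ℤ))
    have h2 := h.comp_injective ((sub_left_injective (b := (1 : ℤ))).comp
      (neg_injective.comp (Nat.cast_injective (R := ℤ))))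
    refine Summable.of_nonneg_of_le (fun n => norm_nonneg _) (fun n => ?_) (h1.add h2)
    rw [hun n ρ]
    exact norm_add_le _ _

end

/-! ### Integral representations of `T'` and `ψ'`. -/

/-- `exists_functional_bound` for functions on `[0, l]`. -/
theorem exists_functional_bound_of_continuousOn {l : ℝ} (hl : 0 < l) {p : ℝ → ℂ}
    (hp : MemLp p 2 (volume.restrict (Set.Icc 0 l))) (h : ℂ) {g u : ℂ → ℝ → ℂ}
    (hg : ∀ ρ, Continuous (g ρ))
    (hd : ∀ (ρ : ℂ) (a τ : ℝ), Complex.cos (ρ * a) * g ρ τ = (g ρ (τ + a) + g ρ (τ - a)) / 2)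
    (hu : ∀ ρ, ContinuousOn (u ρ) (Set.Icc 0 l))
    (hV : ∀ ρ, ∀ t ∈ Set.Icc 0 l, u ρ t = g ρ t + h / 2 * (∫ v in (-t)..t, g ρ v)
      + ∫ s in (0 : ℝ)..t, sinDiv (t - s) ρ * (p s * u ρ s)) :
    ∃ C : ℝ, ∀ σ : ℂ →₀ ℂ, ‖∑ ρ ∈ σ.support, σ ρ *
        ((∫ s in (0 : ℝ)..l, Complex.cos (ρ * (l - s)) * (p s * u ρ s))
          - (1 / 2 * ∫ s in (0 : ℝ)..l, p s) * g ρ l)‖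
      ≤ C * √(∫ v in (-l)..l, ‖∑ ρ ∈ σ.support, σ ρ * g ρ v‖ ^ 2) := by
  -- Extension by the end values makes the functions continuous on all of `ℝ` without changing any
  -- integral over `[0, l]`.
  set w : ℂ → ℝ → ℂ := fun ρ t => u ρ (max 0 (min t l)) with hw
  have hwu : ∀ ρ, ∀ t ∈ Set.Icc 0 l, w ρ t = u ρ t := fun ρ t ht => by
    simp only [hw, min_eq_left ht.2, max_eq_right ht.1]
  have hint : ∀ ρ, ∀ t ∈ Set.Icc 0 l, ∀ f : ℝ → ℂ,
      ∫ s in (0 : ℝ)..t, f s * (p s * w ρ s) = ∫ s in (0 : ℝ)..t, f s * (p s * u ρ s) := by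
    intro ρ t ht f
    refine intervalIntegral.integral_congr fun s hs => ?_
    rw [Set.uIcc_of_le ht.1] at hs
    simp only [hwu ρ s ⟨hs.1, hs.2.trans ht.2⟩]
  obtain ⟨C, hC⟩ := exists_functional_bound hl hp h hg hd (u := w)
    (fun ρ => (hu ρ).comp_continuous (by fun_prop) fun t =>
      ⟨le_max_left _ _, max_le hl.le (min_le_right _ _)⟩)
    (fun ρ t ht => by rw [hwu ρ t ht, hint ρ t ht, hV ρ t ht])
  refine ⟨C, fun σ => ?_⟩
  have := hC σ
  rwa [Finset.sum_congr rfl fun ρ _ => by rw [hint ρ l (Set.right_mem_Icc.2 hl.le)]] at this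

section

variable {q : ℝ → ℂ} {L : ℝ} {ρ : ℂ} {y : ℝ → ℂ}

theorem IsSolution.volterra (hL : 0 < L) (hy : IsSolution q L ρ y) {t : ℝ}
    (ht : t ∈ Set.Icc 0 L) :
    y (L - t) = Complex.cos (ρ * t) * y L - sinDiv t ρ * dx L y L
      + ∫ s in (0 : ℝ)..t, sinDiv (t - s) ρ * (q (L - s) * y (L - s)) := by
  have h := hy.eq_integral hL (x := L - t) ⟨sub_nonneg.2 ht.2, by linarith [ht.1]⟩
  have e := intervalIntegral.integral_comp_sub_left (a := 0) (b := t)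
    (fun s => sinDiv (s - (L - t)) ρ * (q s * y s)) L
  rw [sub_zero] at e
  rw [h, ← e]
  simp only [sub_sub_cancel, sub_sub_sub_cancel_left, Complex.ofReal_sub]

theorem IsSolution.derivative_eq_reflect (hL : 0 < L) (hy : IsSolution q L ρ y) {x : ℝ}
    (hx : x ∈ Set.Icc 0 L) :
    dx L y x = Complex.cos (ρ * (L - x)) * dx L y L + ρ * Complex.sin (ρ * (L - x)) * y L
      - ∫ s in (0 : ℝ)..(L - x), Complex.cos (ρ * ((L - x : ℝ) - s)) * (q (L - s) * y (L - s)) := by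
  have h := hy.derivative_eq hL hx
  have e := intervalIntegral.integral_comp_sub_left (a := 0) (b := L - x)
    (fun s : ℝ => Complex.cos (ρ * (s - x)) * (q s * y s)) L
  rw [sub_zero, sub_sub_cancel] at e
  rw [h, ← e]
  congr 1
  refine intervalIntegral.integral_congr fun s _ => ?_
  push_cast
  ring_nf

theorem memLp_reflect {x : ℝ} (hq : MemLp q 2 (volume.restrict (Set.Icc 0 L)))
    (hx : 0 ≤ x) : MemLp (fun s => q (L - s)) 2 (volume.restrict (Set.Icc 0 (L - x))) := by
  have h := (Measure.measurePreserving_sub_left volume L).restrict_preimage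
    (measurableSet_Icc (a := x) (b := L))
  have e : (fun s => L - s) ⁻¹' Set.Icc x L = Set.Icc 0 (L - x) := by
    ext s
    simp only [Set.mem_preimage, Set.mem_Icc]
    constructor <;> rintro ⟨h1, h2⟩ <;> constructor <;> linarith
  rw [e] at h
  exact (hq.mono_measure (Measure.restrict_mono (Set.Icc_subset_Icc_left hx) le_rfl)
    ).comp_measurePreserving h

theorem omegaL_eq_reflect (q : ℝ → ℂ) (L x : ℝ) :
    omegaL q L x = 1 / 2 * ∫ s in (0 : ℝ)..(L - x), q (L - s) := by
  rw [intervalIntegral.integral_comp_sub_left q, sub_zero, sub_sub_cancel, omegaL]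

end

/-- Splits the Bessel term into a cosine, which cancels the boundary and `ω_L` terms, and a sinc,
which is the cosine transform of a constant. -/
theorem mul_sphericalJ1 (l : ℝ) (ρ : ℂ) :
    ρ * l * sphericalJ1 (ρ * l) = nsinc (ρ * l / Real.pi) - Complex.cos (ρ * l) := by
  by_cases h : ρ * l = 0
  · simp [sphericalJ1, nsinc, h]
  · rw [sphericalJ1, if_neg h, nsinc_mul_div_pi h]
    generalize ρ * (l : ℂ) = z at h ⊢
    field_simp

section

variable {q : ℝ → ℂ} {L x : ℝ} [hl : Fact (0 < 2 * (L - x))]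

/-- The main part of `T'(·, x)` is a sine transform of a square integrable function. -/
theorem exists_sine_representation (hL : 0 < L)
    (hq : MemLp q 2 (volume.restrict (Set.Icc 0 L))) {T : ℂ → ℝ → ℂ}
    (hT : ∀ ρ : ℂ, IsSolution q L ρ (T ρ) ∧ T ρ L = 0 ∧ dx L (T ρ) L = 1)
    (hx : x ∈ Set.Ico 0 L) (θ : ℝ) :
    ∃ k, ∀ ρ, dx L (T ρ) x - (Complex.cos (ρ * (L - x)) + sinDiv (L - x) ρ * omegaL q L x)
      = inner ℂ k (circleLift (L - x) (twistedSinMap θ ρ)) := by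
  have hl0 := half_period_pos (L - x)
  -- The data `T = 0`, `T' = 1` at `L` give the free part `-sin(ρt)/ρ`; the sign is moved to `u =
  -- -T`, and there is no boundary term, so `h = 0`.
  obtain ⟨C, hC⟩ := exists_functional_bound_of_continuousOn hl0 (memLp_reflect hq hx.1) 0
    (g := fun ρ t => sinDiv t ρ) (u := fun ρ t => -T ρ (L - t))
    (fun ρ => continuous_sinDiv.comp (by fun_prop : Continuous fun t : ℝ => (t, ρ)))
    cos_mul_sinDiv_eq_half
    (fun ρ => ((hT ρ).1.continuousOn.comp (by fun_prop) fun t ht =>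
      ⟨by linarith [ht.2, hx.1], by linarith [ht.1]⟩).neg)
    (fun ρ t ht => by
      have h := (hT ρ).1.volterra hL (t := t) ⟨ht.1, by linarith [ht.2, hx.1]⟩
      rw [(hT ρ).2.1, (hT ρ).2.2] at h
      rw [h, zero_div, zero_mul]
      simp only [mul_neg, intervalIntegral.integral_neg]
      ring)
  refine exists_kernel (L - x) (g := fun ρ t => sinDiv t ρ)
    (e := fun v : ℝ => Complex.exp (-(Complex.I * θ * v))) (fun v => ?_) (fun ρ v => rfl)
    (C := C) fun σ => ?_
  · rw [show -(Complex.I * θ * v) = ((-(θ * v) : ℝ) : ℂ) * Complex.I by push_cast; ring,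
      Complex.norm_exp_ofReal_mul_I]
  · refine le_of_eq_of_le (congrArg _ (Finset.sum_congr rfl fun ρ _ => ?_)) (hC σ)
    rw [(hT ρ).1.derivative_eq_reflect hL (Set.Ico_subset_Icc_self hx), (hT ρ).2.1, (hT ρ).2.2,
      omegaL_eq_reflect]
    simp only [mul_neg, intervalIntegral.integral_neg]
    ring

/-- The main part of `ψ'(·, x)` is a cosine transform of a square integrable function. -/
theorem exists_cosine_representation (hL : 0 < L)
    (hq : MemLp q 2 (volume.restrict (Set.Icc 0 L))) (H : ℂ) {ψ : ℂ → ℝ → ℂ}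
    (hψ : ∀ ρ : ℂ, IsSolution q L ρ (ψ ρ) ∧ ψ ρ L = 1 ∧ dx L (ψ ρ) L = -H)
    (hx : x ∈ Set.Ico 0 L) :
    ∃ k, ∀ ρ, dx L (ψ ρ) x - (ρ * Complex.sin (ρ * (L - x))
        + (H + omegaL q L x) * (ρ * (L - x)) * sphericalJ1 (ρ * (L - x)))
      = inner ℂ k (circleLift (L - x) (cosMap ρ)) := by
  have hl0 := half_period_pos (L - x)
  obtain ⟨C, hC⟩ := exists_functional_bound_of_continuousOn hl0 (memLp_reflect hq hx.1) H
    (g := fun ρ t => Complex.cos (ρ * t)) (u := fun ρ t => ψ ρ (L - t))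
    (fun ρ => by fun_prop)
    cos_mul_cos_eq_half
    (fun ρ => (hψ ρ).1.continuousOn.comp (by fun_prop) fun t ht =>
      ⟨by linarith [ht.2, hx.1], by linarith [ht.1]⟩)
    (fun ρ t ht => by
      have h := (hψ ρ).1.volterra hL (t := t) ⟨ht.1, by linarith [ht.2, hx.1]⟩
      -- The slope `-H` contributes `H sin(ρt)/ρ`, which is `H/2` times the integral of the free
      -- part over `[-t, t]`.
      have h2 := cos_mul_sinDiv ρ 0 t
      rw [Complex.ofReal_zero, mul_zero, Complex.cos_zero, zero_sub, zero_add, one_mul] at h2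
      rw [(hψ ρ).2.1, (hψ ρ).2.2] at h
      rw [h]
      linear_combination H * h2)
  obtain ⟨k, hk⟩ := exists_kernel (L - x) (φ := cosMap) (g := fun ρ t => Complex.cos (ρ * t))
    (e := fun _ => 1) (fun v => norm_one) (fun ρ v => (one_mul _).symm) hC
  -- The zeroth basis vector represents `sinc(ρl/π)`; its coefficient is conjugated because the
  -- pairing is conjugate linear in the first slot.
  refine ⟨-k - (starRingEnd ℂ) (H + omegaL q L x) • fourierBasis (T := 2 * (L - x)) 0,
    fun ρ => ?_⟩
  have hJ := mul_sphericalJ1 (L - x) ρ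
  push_cast at hJ
  rw [inner_sub_left, inner_neg_left, inner_smul_left, Complex.conj_conj,
    inner_fourierBasis_cosMap, ← hk, mul_assoc (H + _), hJ,
    (hψ ρ).1.derivative_eq_reflect hL (Set.Ico_subset_Icc_self hx), (hψ ρ).2.1, (hψ ρ).2.2,
    ← omegaL_eq_reflect]
  push_cast
  ring_nf

end

theorem SeriesConverges.tendsto_add {u : ℕ → ℂ → ℂ} {f A : ℂ → ℂ}
    (h : SeriesConverges u fun ρ => f ρ - A ρ) (ρ : ℂ) :
    Tendsto (fun N : ℕ => A ρ + ∑ n ∈ Finset.range N, u n ρ) atTop (𝓝 (f ρ)) := by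
  have h1 := (h.compacts {ρ} isCompact_singleton).tendsto_at (Set.mem_singleton ρ)
  simpa using h1.const_add (A ρ)

end CardinalSeries

end

/-! ### The two cardinal series. -/

theorem mainTheorem7 (L : ℝ) (hL : 0 < L) (q : ℝ → ℂ)
    (hq : MemLp q 2 (volume.restrict (Set.Icc 0 L))) (H : ℂ)
    (T ψ : ℂ → ℝ → ℂ)
    (hT : ∀ ρ : ℂ, CardinalSeries.IsSolution q L ρ (T ρ) ∧
      T ρ L = 0 ∧ CardinalSeries.dx L (T ρ) L = 1)
    (hψ : ∀ ρ : ℂ, CardinalSeries.IsSolution q L ρ (ψ ρ) ∧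
      ψ ρ L = 1 ∧ CardinalSeries.dx L (ψ ρ) L = -H)
    (x : ℝ) (hx : x ∈ Set.Ico 0 L) :
    -- the representation of `T'`
    (∀ ρ : ℂ, Tendsto (fun N : ℕ =>
        Complex.cos (ρ * (L - x)) + CardinalSeries.sinDiv (L - x) ρ * CardinalSeries.omegaL q L x
          + ∑ n ∈ Finset.range N,
              CardinalSeries.tCoeff q L T x n * CardinalSeries.oddQuot (L - x) n ρ)
        atTop (𝓝 (CardinalSeries.dx L (T ρ) x))) ∧
    -- convergence of its series, with the factor `1 / (2 ρ sin (ρ (L - x)))`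
    CardinalSeries.SeriesConverges
      (fun n ρ => CardinalSeries.tCoeff q L T x n * CardinalSeries.oddQuot (L - x) n ρ)
      (fun ρ => CardinalSeries.dx L (T ρ) x
        - (Complex.cos (ρ * (L - x))
          + CardinalSeries.sinDiv (L - x) ρ * CardinalSeries.omegaL q L x)) ∧
    -- convergence of its series, without that factor
    CardinalSeries.SeriesConverges
      (fun n ρ => CardinalSeries.tCoeff q L T x n * CardinalSeries.oddPair (L - x) n ρ)
      (fun ρ => 2 * ρ * Complex.sin (ρ * (L - x)) * (CardinalSeries.dx L (T ρ) x
        - (Complex.cos (ρ * (L - x))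
          + CardinalSeries.sinDiv (L - x) ρ * CardinalSeries.omegaL q L x))) ∧
    -- the representation of `ψ'`
    (∀ ρ : ℂ, Tendsto (fun N : ℕ =>
        ρ * Complex.sin (ρ * (L - x))
          + (H + CardinalSeries.omegaL q L x) * (ρ * (L - x))
            * CardinalSeries.sphericalJ1 (ρ * (L - x))
          + ∑ n ∈ Finset.range N,
              CardinalSeries.psiCoeff q L H ψ x n * CardinalSeries.evenPair (x - L) n ρ)
        atTop (𝓝 (CardinalSeries.dx L (ψ ρ) x))) ∧
    -- convergence of its series
    CardinalSeries.SeriesConverges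
      (fun n ρ => CardinalSeries.psiCoeff q L H ψ x n * CardinalSeries.evenPair (x - L) n ρ)
      (fun ρ => CardinalSeries.dx L (ψ ρ) x
        - (ρ * Complex.sin (ρ * (L - x))
          + (H + CardinalSeries.omegaL q L x) * (ρ * (L - x))
            * CardinalSeries.sphericalJ1 (ρ * (L - x)))) := by
  have hlx : 0 < L - x := sub_pos.2 hx.2
  have hlx' : (L : ℂ) - x ≠ 0 := by
    rw [← Complex.ofReal_sub]
    exact_mod_cast hlx.ne'
  have : Fact (0 < 2 * (L - x)) := ⟨by linarith⟩
  obtain ⟨k, hk⟩ := CardinalSeries.exists_sine_representation hL hq hT hx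
    (Real.pi / (2 * (L - x)))
  obtain ⟨k', hk'⟩ := CardinalSeries.exists_cosine_representation hL hq H hψ hx
  -- At `ρ = (2n+1)π/(2(L-x))` the cosine vanishes and the sine is `(-1)^n`, so the `ω_L` term,
  -- multiplied by `2ρ(-1)^n`, becomes `2ω_L`.
  have hct : ∀ n : ℕ, CardinalSeries.tCoeff q L T x n
      = (-1) ^ n * ((2 * n + 1) * Real.pi / (L - x : ℝ))
        * (fun ρ => CardinalSeries.dx L (T ρ) x - (Complex.cos (ρ * (L - x))
          + CardinalSeries.sinDiv (L - x) ρ * CardinalSeries.omegaL q L x))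
          ((2 * n + 1) / (2 * (L - x : ℝ)) * Real.pi) := by
    intro n
    have hr : (2 * n + 1 : ℂ) / (2 * (L - x)) * Real.pi * (L - x)
        = n * Real.pi + Real.pi / 2 := by
      field_simp
    have hcos : Complex.cos (n * Real.pi + Real.pi / 2) = 0 := by
      rw [Complex.cos_add_pi_div_two, Complex.sin_nat_mul_pi, neg_zero]
    have hsin : Complex.sin (n * Real.pi + Real.pi / 2) = (-1) ^ n := by
      rw [Complex.sin_add_pi_div_two, CardinalSeries.complex_cos_nat_mul_pi]
    have hsd := CardinalSeries.mul_sinDiv (L - x) ((2 * n + 1) / (2 * (L - x)) * Real.pi)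
    rw [Complex.ofReal_sub, hr, hsin] at hsd
    have e : ((-1 : ℂ) ^ n) * (-1) ^ n = 1 := by rw [← mul_pow]; simp
    have e3 : (2 * n + 1) * Real.pi / (L - x) = 2 * ((2 * n + 1) / (2 * (L - x)) * Real.pi : ℂ) := by
      field_simp
    rw [CardinalSeries.tCoeff]
    simp only [Complex.ofReal_sub, hr, hcos]
    rw [e3]
    linear_combination (2 * (-1) ^ n * CardinalSeries.omegaL q L x) * hsd
      + 2 * CardinalSeries.omegaL q L x * e
  have hcψ : ∀ n : ℕ, n ≠ 0 → CardinalSeries.psiCoeff q L H ψ x n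
      = (fun ρ => CardinalSeries.dx L (ψ ρ) x - (ρ * Complex.sin (ρ * (L - x))
        + (H + CardinalSeries.omegaL q L x) * (ρ * (L - x))
          * CardinalSeries.sphericalJ1 (ρ * (L - x)))) (n * Real.pi / (L - x : ℝ)) := by
    intro n hn
    have hr : (n : ℂ) * Real.pi / (L - x) * (L - x) = n * Real.pi := by field_simp
    have hn' : (n : ℂ) ≠ 0 := by exact_mod_cast hn
    have hpi : (Real.pi : ℂ) ≠ 0 := by exact_mod_cast Real.pi_ne_zero
    rw [CardinalSeries.psiCoeff, if_neg hn]
    simp only [Complex.ofReal_sub, hr, CardinalSeries.sphericalJ1, mul_ne_zero hn' hpi, if_false,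
      Complex.sin_nat_mul_pi, CardinalSeries.complex_cos_nat_mul_pi]
    field_simp
    ring
  have hcψ0 : CardinalSeries.psiCoeff q L H ψ x 0
      = (fun ρ => CardinalSeries.dx L (ψ ρ) x - (ρ * Complex.sin (ρ * (L - x))
        + (H + CardinalSeries.omegaL q L x) * (ρ * (L - x))
          * CardinalSeries.sphericalJ1 (ρ * (L - x)))) 0 / 2 := by
    simp [CardinalSeries.psiCoeff]
  have s1 := CardinalSeries.seriesConverges_oddQuot (L - x) k hk (m := fun _ => 1)
    continuous_const
    (fun ρ => by
      rw [one_smul]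
      exact CardinalSeries.norm_circleLift_twistedSinMap_le (L - x) _ ρ)
    (by
      simp only [one_smul]
      exact CardinalSeries.isBessel_twistedSinMap (L - x) _) hct
  simp only [one_mul] at s1
  have hsin : ∀ ρ : ℝ, ‖2 * Complex.sin ((ρ : ℂ) * (L - x))‖ ≤ 2 := fun ρ => by
    rw [← Complex.ofReal_sub, ← Complex.ofReal_mul, ← Complex.ofReal_sin, norm_mul,
      Complex.norm_real, Complex.norm_ofNat]
    linarith [Real.abs_sin_le_one (ρ * (L - x)), Real.norm_eq_abs (Real.sin (ρ * (L - x)))]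
  -- The multiplier is unbounded on `ℝ`, but its factor `ρ` cancels the denominator of the twisted
  -- sine, and `2 sin` is bounded by 2.
  have s2 := CardinalSeries.seriesConverges_oddQuot (L - x) k hk
    (m := fun ρ => 2 * ρ * Complex.sin (ρ * (L - x))) (by fun_prop) (M := 2 * 1)
    (fun ρ => by
      rw [mul_right_comm, mul_smul, norm_smul]
      exact mul_le_mul (hsin ρ)
        (CardinalSeries.norm_smul_circleLift_twistedSinMap_le (L - x) _ ρ) (norm_nonneg _)
        zero_le_two)
    ((CardinalSeries.isBessel_smul_twistedSinMap (L - x) _).mono (M := 2) fun k ρ => by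
      rw [mul_right_comm, mul_smul, inner_smul_right, norm_mul]
      exact mul_le_mul_of_nonneg_right (hsin ρ) (norm_nonneg _)) hct
  have s3 := CardinalSeries.seriesConverges_evenPair (L - x) k' hk' hcψ0 hcψ
  rw [neg_sub] at s3
  refine ⟨s1.tendsto_add, s1, ?_, s3.tendsto_add, s3⟩
  convert s2 using 3 with n ρ
  rw [CardinalSeries.oddPair_eq_mul_sinCoeff, CardinalSeries.oddQuot_eq, Complex.ofReal_sub]
  ring
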